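/- Conventions. All structures have universe $\omega$ and a computable relational language, and a structure is identified with its atomic diagram, coded as an element of $2^\omega$; a copy of $\mathcal A$ is a structure with universe $\omega$ isomorphic to $\mathcal A$. So a graph is a simple undirected graph with vertex set $\omega$, and a linear ordering is a linear ordering of the set $\omega$. We write $\mathcal A\leq_s\mathcal B$ ($\mathcal A$ is Medvedev reducible to $\mathcal B$) if there is a Turing operator that takes every copy of $\mathcal B$ to a copy of $\mathcal A$. A computable $\Sigma_1$ formula is a c.e. disjunction of finitary existential formulas in a fixed finite tuple of free variables; a computable $\Pi_1$ formula is the negation of a computable $\Sigma_1$ formula; a computable $\Sigma_2$ formula is a c.e. disjunction of formulas $\exists\bar u\,\psi$ with $\psi$ a computable $\Pi_1$ formula. The jump of $\mathcal A$ is the structure $\mathcal A'=(\mathcal A,(R_i)_{i\in\omega})$, where $R_i$ is the relation defined in $\mathcal A$ by the $i$-th computable $\Sigma_1$ formula. A relation between finite tuples (of arbitrary lengths) from $\mathcal B$ is defined by computable $\Sigma_2$ formulas if its restrictions to tuples of fixed lengths are defined, without parameters, by computable $\Sigma_2$ formulas that can be found computably from the lengths. $\mathcal A=(\omega,(R_i)_i)$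 is interpreted in $\mathcal B$ by computable $\Sigma_2$ formulas if there are a set $D\subseteq\mathcal B^{<\omega}$, an equivalence relation $\sim$ on $D$, and relations $R_i^*$ on $D$ compatible with $\sim$, such that $D$, $\sim$, the $R_i^*$, and the complements of $\sim$ and of the $R_i^*$ in the appropriate powers of $D$ are defined in $\mathcal B$ by computable $\Sigma_2$ formulas (uniformly in $i$), and $(D,(R_i^*)_i)/_\sim\cong\mathcal A$. Proposition. There is a graph $G$ with the following properties. 1. $G$ codes a non-$\Delta^0_2$ set: there is a set $S\subseteq\omega$ that is not $\Delta^0_2$ and is computable from every copy of $G$. 2. For every linear ordering $L$, $G\not\leq_s L'$. 3. For every linear ordering $L$, $G$ is not interpreted in $L$ by computable $\Sigma_2$ formulas. -/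

import Mathlib

namespace EffStr

/-! ### Structures with universe `ℕ` in a computable relational language -/

/-- A computable relational language: the symbols are (effectively coded by) natural numbers and
the arity of a symbol is computable. -/
structure Signature where
  Sym : Type
  [primcodable : Primcodable Sym]
  arity : Sym → ℕ
  arity_computable : Computable arity

attribute [instance] Signature.primcodable

/-- A structure with universe `ℕ`. A `k`-ary relation is a predicate on lists of length `k`. -/
structure Struc (τ : Signature) where
  Rel : τ.Sym → List ℕ → Prop
  length_eq : ∀ s v, Rel s v → v.length = τ.arity s

/-- `B` is isomorphic to `A`; since both have universe `ℕ`, `B` is then called a copy of `A`. -/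
def IsCopy {τ : Signature} (A B : Struc τ) : Prop :=
  ∃ f : ℕ ≃ ℕ, ∀ s v, A.Rel s v ↔ B.Rel s (v.map f)

/-- The atomic diagram, as a set of natural numbers: the codes of the pairs (symbol, tuple) for
which the atomic formula holds. (The equalities between elements of `ℕ` are decidable, and the
negated atomic formulas are read off from the complement.) -/
def diagram {τ : Signature} (A : Struc τ) : Set ℕ :=
  {k | ∃ (s : τ.Sym) (v : List ℕ), Encodable.encode (s, v) = k ∧ A.Rel s v}

/-- The characteristic function of a set of natural numbers. -/
noncomputable def chi (X : Set ℕ) : ℕ → ℕ := X.indicator 1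

/-! ### Turing operators and Medvedev reducibility -/

/-- Programs for oracle computations: the clauses of `Nat.RecursiveIn`, as syntax. -/
inductive OracleCode : Type
  | zero : OracleCode
  | succ : OracleCode
  | left : OracleCode
  | right : OracleCode
  | oracle : OracleCode
  | pair : OracleCode → OracleCode → OracleCode
  | comp : OracleCode → OracleCode → OracleCode
  | prec : OracleCode → OracleCode → OracleCode
  | rfind : OracleCode → OracleCode

/-- The partial function computed by a program with oracle `g`. A program `c` thus gives the
Turing operator `g ↦ c.eval g`. -/
def OracleCode.eval (g : ℕ → ℕ) : OracleCode → ℕ →. ℕ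
  | .zero => fun _ => Part.some 0
  | .succ => fun n => Part.some (n + 1)
  | .left => fun n => Part.some (Nat.unpair n).1
  | .right => fun n => Part.some (Nat.unpair n).2
  | .oracle => fun n => Part.some (g n)
  | .pair c d => fun n => Nat.pair <$> c.eval g n <*> d.eval g n
  | .comp c d => fun n => d.eval g n >>= c.eval g
  | .prec c d => fun p =>
      (Nat.unpair p).2.rec (c.eval g (Nat.unpair p).1) fun y IH => do
        let i ← IH
        d.eval g (Nat.pair (Nat.unpair p).1 (Nat.pair y i))
  | .rfind c => fun a =>
      Nat.rfind fun n => (fun m => decide (m = 0)) <$> c.eval g (Nat.pair a n)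

/-- Some Turing operator takes (the atomic diagram of) every copy of `B` to (the atomic diagram
of) a copy of `A`. -/
def MedvedevReducible {τ ρ : Signature} (A : Struc τ) (B : Struc ρ) : Prop :=
  ∃ c : OracleCode, ∀ B' : Struc ρ, IsCopy B B' →
    ∃ A' : Struc τ, IsCopy A A' ∧
      ∀ n, c.eval (chi (diagram B')) n = Part.some (chi (diagram A') n)

/-- The set `S` is computable relative to (the atomic diagram of) `A`. -/
def Computes {τ : Signature} (A : Struc τ) (S : Set ℕ) : Prop :=
  TuringReducible (fun n => Part.some (chi S n)) (fun n => Part.some (chi (diagram A) n))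

/-! ### The classes `Σ⁰₂` and `Δ⁰₂` -/

/-- `n ∈ S ↔ ∃ x, ∀ y, R n x y` for a computable relation `R`. -/
def IsSigmaZeroTwo (S : Set ℕ) : Prop :=
  ∃ R : ℕ × ℕ × ℕ → Prop, ComputablePred R ∧ ∀ n, n ∈ S ↔ ∃ x, ∀ y, R (n, x, y)

def IsDeltaZeroTwo (S : Set ℕ) : Prop :=
  IsSigmaZeroTwo S ∧ IsSigmaZeroTwo Sᶜ

/-! ### Computable infinitary formulas -/

/-- An atomic formula: `x_i = x_j`, or a symbol applied to a list of variables, where a variable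
is given by its index. -/
abbrev Atom (τ : Signature) : Type := (ℕ × ℕ) ⊕ (τ.Sym × List ℕ)

/-- A literal: an atomic formula (`true`) or the negation of one (`false`). -/
abbrev Literal (τ : Signature) : Type := Bool × Atom τ

/-- A finitary quantifier-free formula, in disjunctive normal form. -/
abbrev QFree (τ : Signature) : Type := List (List (Literal τ))

/-- A finitary existential formula in the free variables `x_0, …, x_{n-1}`: the pair `(m, θ)`
stands for `∃ x_n … x_{n+m-1}, θ`. -/
abbrev Existential (τ : Signature) : Type := ℕ × QFree τ

/-- The atomic formula is well formed and its variables are among `x_0, …, x_{k-1}`. -/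
def Atom.WF {τ : Signature} (k : ℕ) : Atom τ → Prop
  | .inl (i, j) => i < k ∧ j < k
  | .inr (s, v) => v.length = τ.arity s ∧ ∀ i ∈ v, i < k

def QFree.WF {τ : Signature} (k : ℕ) (θ : QFree τ) : Prop :=
  ∀ C ∈ θ, ∀ l ∈ C, Atom.WF k l.2

/-- Truth in `A` of an atomic formula when `x_i` denotes the `i`-th entry of `a`. (The default
value is never used for a well-formed formula.) -/
def Atom.Holds {τ : Signature} (A : Struc τ) (a : List ℕ) : Atom τ → Prop
  | .inl (i, j) => a.getD i 0 = a.getD j 0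
  | .inr (s, v) => A.Rel s (v.map fun i => a.getD i 0)

def Literal.Holds {τ : Signature} (A : Struc τ) (a : List ℕ) (l : Literal τ) : Prop :=
  if l.1 then Atom.Holds A a l.2 else ¬ Atom.Holds A a l.2

def QFree.Holds {τ : Signature} (A : Struc τ) (a : List ℕ) (θ : QFree τ) : Prop :=
  ∃ C ∈ θ, ∀ l ∈ C, Literal.Holds A a l

/-- Membership in the c.e. set with index `e` (the domain of the partial recursive function with
program `e`), for objects coded by natural numbers. -/
def InCE {α : Type} [Primcodable α] (e : Nat.Partrec.Code) (x : α) : Prop :=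
  (e.eval (Encodable.encode x)).Dom

/-- The computable `Σ₁` formula with index `e` in the free variables `x_0, …, x_{n-1}` is the
disjunction of the finitary existential formulas in these free variables whose codes are in the
c.e. set with index `e`. This is its truth in `A` at the `n`-tuple `a`. -/
def SigmaOneHolds {τ : Signature} (A : Struc τ) (n : ℕ) (e : Nat.Partrec.Code)
    (a : List ℕ) : Prop :=
  a.length = n ∧ ∃ φ : Existential τ, InCE e φ ∧ QFree.WF (n + φ.1) φ.2 ∧
    ∃ b : List ℕ, b.length = φ.1 ∧ QFree.Holds A (a ++ b) φ.2

/-- The computable `Σ₂` formula with index `e` in the free variables `x_0, …, x_{n-1}` is the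
disjunction, over the pairs `(m, d)` in the c.e. set with index `e`, of the formulas
`∃ x_n … x_{n+m-1}, ψ`, where `ψ` is the computable `Π₁` formula with index `d` in the variables
`x_0, …, x_{n+m-1}`, that is, the negation of the computable `Σ₁` formula with this index.
This is its truth in `A` at the `n`-tuple `a`. -/
def SigmaTwoHolds {τ : Signature} (A : Struc τ) (n : ℕ) (e : Nat.Partrec.Code)
    (a : List ℕ) : Prop :=
  a.length = n ∧ ∃ (m : ℕ) (d : Nat.Partrec.Code), InCE e (m, d) ∧
    ∃ b : List ℕ, b.length = m ∧ ¬ SigmaOneHolds A (n + m) d (a ++ b)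

/-! ### The jump of a structure -/

/-- The language of the jump: a new `n`-ary symbol for each computable `Σ₁` formula in the free
variables `x_0, …, x_{n-1}`, given by `n` and an index. -/
def jumpSignature (τ : Signature) : Signature where
  Sym := τ.Sym ⊕ (ℕ × Nat.Partrec.Code)
  arity := Sum.elim τ.arity Prod.fst
  arity_computable := by
    have h : Computable fun x : τ.Sym ⊕ (ℕ × Nat.Partrec.Code) =>
        (Sum.casesOn x τ.arity Prod.fst : ℕ) :=
      Computable.sumCasesOn Computable.id
        ((τ.arity_computable.comp Computable.snd).to₂)
        ((Computable.fst.comp Computable.snd).to₂)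
    refine h.of_eq ?_
    rintro (x | x) <;> rfl

/-- The jump of `A`: the structure `A` together with all relations defined in `A` by computable
`Σ₁` formulas. -/
def jump {τ : Signature} (A : Struc τ) : Struc (jumpSignature τ) where
  Rel := Sum.elim A.Rel fun p => SigmaOneHolds A p.1 p.2
  length_eq := by
    rintro (s | p) v h
    · exact A.length_eq s v h
    · exact h.1

/-! ### Interpretations by computable `Σ₂` formulas -/

/-- A family, indexed by `ι`, of relations between tuples of arbitrary finite length from `A` is
uniformly defined in `A` by computable `Σ₂` formulas without parameters: computably in the index
and in the lengths of the tuples there is a computable `Σ₂` formula that defines the relation on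
tuples of these lengths. -/
def UniformlySigmaTwo {τ : Signature} (A : Struc τ) {ι : Type} [Primcodable ι]
    (R : ι → List (List ℕ) → Prop) : Prop :=
  ∃ f : ι → List ℕ → Nat.Partrec.Code, Computable₂ f ∧
    ∀ i t, R i t ↔
      SigmaTwoHolds A (t.map List.length).sum (f i (t.map List.length)) t.flatten

/-- A set `D` of finite tuples from `B`, a relation `∼` on `D`, and for each symbol `s` of the
language of `A` a relation on `D` of the arity of `s`, such that `D`, the relations, and their
complements in the powers of `D` are defined in `B` by computable `Σ₂` formulas, and the quotient
by `∼` is isomorphic to `A` (through the map induced by `π`). -/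
structure SigmaTwoInterpretation {τ ρ : Signature} (A : Struc τ) (B : Struc ρ) where
  D : Set (List ℕ)
  sim : D → D → Prop
  Rel : τ.Sym → List D → Prop
  rel_length : ∀ s t, Rel s t → t.length = τ.arity s
  D_def : UniformlySigmaTwo B fun (_ : Unit) t => ∃ a : D, t = [a.1]
  sim_def : UniformlySigmaTwo B fun (_ : Unit) t => ∃ a b : D, t = [a.1, b.1] ∧ sim a b
  not_sim_def : UniformlySigmaTwo B fun (_ : Unit) t => ∃ a b : D, t = [a.1, b.1] ∧ ¬ sim a b
  rel_def : UniformlySigmaTwo B fun (s : τ.Sym) t =>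
    ∃ u : List D, t = u.map Subtype.val ∧ Rel s u
  not_rel_def : UniformlySigmaTwo B fun (s : τ.Sym) t =>
    ∃ u : List D, t = u.map Subtype.val ∧ u.length = τ.arity s ∧ ¬ Rel s u
  π : D → ℕ
  π_surjective : Function.Surjective π
  π_eq_iff : ∀ a b, π a = π b ↔ sim a b
  π_rel : ∀ s u, Rel s u ↔ A.Rel s (u.map π)

/-- `A` is interpreted in `B` by computable `Σ₂` formulas. -/
def IsSigmaTwoInterpreted {τ ρ : Signature} (A : Struc τ) (B : Struc ρ) : Prop :=
  Nonempty (SigmaTwoInterpretation A B)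

/-! ### Graphs and linear orderings -/

/-- The language with one binary relation symbol. -/
def binarySignature : Signature where
  Sym := Unit
  arity := fun _ => 2
  arity_computable := Computable.const 2

/-- The structure with universe `ℕ` and one binary relation `r`. -/
def binaryStruc (r : ℕ → ℕ → Prop) : Struc binarySignature where
  Rel := fun _ v => ∃ a b, v = [a, b] ∧ r a b
  length_eq := by
    rintro s v ⟨a, b, rfl, -⟩
    rfl

/-- A graph with vertex set `ℕ` as a structure. -/
def ofGraph (G : SimpleGraph ℕ) : Struc binarySignature := binaryStruc G.Adj

/-- A linear ordering of the set `ℕ` (not necessarily the usual one) as a structure. -/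
def ofOrder (L : LinearOrder ℕ) : Struc binarySignature := binaryStruc L.lt

end EffStr

/-! Fix a set `S` that is not $\Delta^0_2$ and let `G` be a disjoint union of cycles, the `n`-th of
length $2n+3$ or $2n+4$ according to whether $n\in S$, together with isolated points. Every copy of
`G` enumerates the lengths of its cycles, hence both `S` and its complement, and so computes `S`.
The other two claims follow once the set of cycle lengths of `G` is shown to be $\Sigma^0_2$
whenever `G` is Medvedev reducible to the jump of a linear ordering `L`
(`sigTwo_hasCycle_of_medvedevReducible`) or is interpreted in `L`
(`sigTwo_hasCycle_of_isSigmaTwoInterpreted`), for then `S` would be $\Delta^0_2$.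

Call a finite increasing tuple of `L` saturated if every gap between neighbours, including the two
outer gaps, is empty or infinite; its word records which. Every finite set lies in a saturated tuple
(`exists_path`). The truth of a computable $\Sigma_1$ formula at a saturated tuple depends only on
the word, since an infinite gap has room for any finite number of witnesses and an empty one has
room for none (`sigmaOneHolds_iff_wordHolds`). Truth is therefore c.e. in the word
(`sigOne_wordHolds`).

The set of words realized in `L` is c.e., however complicated `L` is (`sigOne_pathWord`). Indeed,
deleting a point next to an infinite gap preserves saturation. As `L` is infinite, each realized
word has an infinite gap, and closure under such deletions makes the set downward closed for an
order that is a well-quasi-order by Higman's lemma. The complement is then generated by finitely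
many words; only the existence of this finite list is used.

Consequently a property witnessed by finitely many facts about $L'$ is $\Sigma^0_2$: guess a
realized word, positions in it and the facts, and check them against the word. For a Turing operator
the facts are a finite piece of the diagram of a copy of $L'$ from which the operator outputs a
cycle; any piece consistent with a realized word extends to an actual copy, on which the operator
must be correct (`hasCycle_iff_word`). For an interpretation the facts are instances of $\Sigma_2$
formulas (`exists_defines_iff_word`). -/

namespace EffStr

/-! ### Arithmetical predicates -/

section Arithmetical

variable {α β γ : Type} [Primcodable α] [Primcodable β] [Primcodable γ]

/-- Projections of primitive recursive predicates. -/
def SigOne (P : α → Prop) : Prop :=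
  ∃ R : α × ℕ → Prop, PrimrecPred R ∧ ∀ a, P a ↔ ∃ y, R (a, y)

/-- Projections of complements of `SigOne` predicates. -/
def SigTwo (P : α → Prop) : Prop :=
  ∃ Q : α × ℕ → Prop, SigOne Q ∧ ∀ a, P a ↔ ∃ x, ¬ Q (a, x)

theorem SigOne.of_iff {P Q : α → Prop} (h : SigOne P) (H : ∀ a, Q a ↔ P a) : SigOne Q := by
  obtain ⟨R, hR, e⟩ := h
  exact ⟨R, hR, fun a => (H a).trans (e a)⟩

theorem SigTwo.of_iff {P Q : α → Prop} (h : SigTwo P) (H : ∀ a, Q a ↔ P a) : SigTwo Q := by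
  obtain ⟨R, hR, e⟩ := h
  exact ⟨R, hR, fun a => (H a).trans (e a)⟩

theorem SigOne.of_primrec {P : α → Prop} (h : PrimrecPred P) : SigOne P :=
  ⟨fun p => P p.1, h.comp Primrec.fst, fun a => by simp⟩

theorem SigOne.comp_primrec {P : α → Prop} {f : β → α} (h : SigOne P) (hf : Primrec f) :
    SigOne fun b => P (f b) := by
  obtain ⟨R, hR, e⟩ := h
  exact ⟨fun p => R (f p.1, p.2),
    hR.comp (Primrec.pair (hf.comp Primrec.fst) Primrec.snd), fun b => e (f b)⟩

theorem SigOne.and {P Q : α → Prop} (hP : SigOne P) (hQ : SigOne Q) :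
    SigOne fun a => P a ∧ Q a := by
  obtain ⟨R, hR, e⟩ := hP
  obtain ⟨R', hR', e'⟩ := hQ
  have h1 : Primrec fun p : α × ℕ => (p.1, p.2.unpair.1) :=
    Primrec.pair Primrec.fst (Primrec.fst.comp (Primrec.unpair.comp Primrec.snd))
  have h2 : Primrec fun p : α × ℕ => (p.1, p.2.unpair.2) :=
    Primrec.pair Primrec.fst (Primrec.snd.comp (Primrec.unpair.comp Primrec.snd))
  refine ⟨_, (hR.comp h1).and (hR'.comp h2), fun a => ?_⟩
  refine (and_congr (e a) (e' a)).trans ?_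
  constructor
  · rintro ⟨⟨y, hy⟩, z, hz⟩
    exact ⟨Nat.pair y z, by simpa using hy, by simpa using hz⟩
  · rintro ⟨y, hy, hz⟩
    exact ⟨⟨_, hy⟩, _, hz⟩

theorem SigOne.or {P Q : α → Prop} (hP : SigOne P) (hQ : SigOne Q) :
    SigOne fun a => P a ∨ Q a := by
  obtain ⟨R, hR, e⟩ := hP
  obtain ⟨R', hR', e'⟩ := hQ
  refine ⟨_, hR.or hR', fun a => ?_⟩
  exact (or_congr (e a) (e' a)).trans exists_or.symm

theorem primrecPred_exists_option {f : α → Option β} {R : α → β → Prop} (hf : Primrec f)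
    (hR : PrimrecPred fun p : α × β => R p.1 p.2) : PrimrecPred fun a => ∃ b ∈ f a, R a b := by
  classical
  obtain ⟨_, hR⟩ := hR
  have : Primrec fun a => Option.casesOn (motive := fun _ => Bool) (f a) false
      fun b => decide (R a b) :=
    Primrec.option_casesOn hf (Primrec.const false) (hR.of_eq fun p => by congr)
  refine ⟨Classical.decPred _, this.of_eq fun a => ?_⟩
  cases h : f a <;> simp [h]

theorem SigOne.ex {P : α × β → Prop} (h : SigOne P) : SigOne fun a => ∃ b, P (a, b) := by
  obtain ⟨R, hR, e⟩ := h
  refine ⟨fun p => ∃ b ∈ (Encodable.decode p.2.unpair.1 : Option β), R ((p.1, b), p.2.unpair.2),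
    primrecPred_exists_option (Primrec.decode.comp (Primrec.fst.comp
      (Primrec.unpair.comp Primrec.snd))) (hR.comp ?_), fun a => ?_⟩
  · exact Primrec.pair (Primrec.pair (Primrec.fst.comp Primrec.fst) Primrec.snd)
      (Primrec.snd.comp (Primrec.unpair.comp (Primrec.snd.comp Primrec.fst)))
  · constructor
    · rintro ⟨b, hb⟩
      obtain ⟨y, hy⟩ := (e (a, b)).1 hb
      exact ⟨Nat.pair (Encodable.encode b) y, b, by simp, by simpa using hy⟩
    · rintro ⟨y, b, -, hb⟩
      exact ⟨b, (e (a, b)).2 ⟨_, hb⟩⟩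

theorem primrecPred_forall_lt {R : α → ℕ → Prop} {f : α → ℕ}
    (hR : PrimrecPred fun p : α × ℕ => R p.1 p.2) (hf : Primrec f) :
    PrimrecPred fun a => ∀ i < f a, R a i := by
  have h1 : PrimrecRel fun (i : ℕ) (a : α) => R a i := hR.comp (Primrec.pair Primrec.snd Primrec.fst)
  exact (h1.forall_mem_list.comp (Primrec.list_range.comp hf) Primrec.id).of_eq fun a => by simp

theorem primrecPred_exists_lt {R : α → ℕ → Prop} {f : α → ℕ}
    (hR : PrimrecPred fun p : α × ℕ => R p.1 p.2) (hf : Primrec f) :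
    PrimrecPred fun a => ∃ i < f a, R a i := by
  have h1 : PrimrecRel fun (i : ℕ) (a : α) => R a i := hR.comp (Primrec.pair Primrec.snd Primrec.fst)
  exact (h1.exists_mem_list.comp (Primrec.list_range.comp hf) Primrec.id).of_eq fun a => by simp

/-- Collection: finitely many witnesses have a common bound, and that bound is the single outer
witness. -/
theorem SigOne.ball {P : α → ℕ → Prop} {f : α → ℕ} (h : SigOne fun p : α × ℕ => P p.1 p.2)
    (hf : Primrec f) : SigOne fun a => ∀ i < f a, P a i := by
  obtain ⟨R, hR, e⟩ := h
  refine ⟨fun p => ∀ i < f p.1, ∃ y < p.2, R ((p.1, i), y),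
    primrecPred_forall_lt (primrecPred_exists_lt (hR.comp ?_)
      (Primrec.snd.comp Primrec.fst)) (hf.comp Primrec.fst), fun a => ?_⟩
  · exact Primrec.pair (Primrec.pair (Primrec.fst.comp (Primrec.fst.comp Primrec.fst))
      (Primrec.snd.comp Primrec.fst)) Primrec.snd
  · constructor
    · intro H
      choose g hg using fun i => fun hi => (e (a, i)).1 (H i hi)
      refine ⟨(Finset.range (f a)).sup (fun i => if hi : i < f a then g i hi else 0) + 1,
        fun i hi => ⟨g i hi, Nat.lt_succ_of_le ?_, hg i hi⟩⟩
      have := Finset.le_sup (f := fun i => if hi : i < f a then g i hi else 0)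
        (Finset.mem_range.2 hi)
      simpa only [hi, dif_pos] using this
    · rintro ⟨B, hB⟩ i hi
      obtain ⟨y, -, hy⟩ := hB i hi
      exact (e (a, i)).2 ⟨y, hy⟩

/-- The graph of a partial recursive function. -/
theorem SigOne.graph {f : α →. β} (hf : Partrec f) : SigOne fun p : α × β => p.2 ∈ f p.1 := by
  obtain ⟨c, hc⟩ := Nat.Partrec.Code.exists_code.1 hf
  -- The existential witness is the step bound of `evaln`, which makes the matrix primitive
  -- recursive.
  refine ⟨fun p => Nat.Partrec.Code.evaln p.2 c (Encodable.encode p.1.1) =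
    some (Encodable.encode p.1.2), ?_, ?_⟩
  · exact Primrec.eq.comp (Nat.Partrec.Code.primrec_evaln.comp (Primrec.pair
      (Primrec.pair Primrec.snd (Primrec.const c))
      (Primrec.encode.comp (Primrec.fst.comp Primrec.fst))))
      (Primrec.option_some.comp (Primrec.encode.comp (Primrec.snd.comp Primrec.fst)))
  · rintro ⟨a, b⟩
    have := @Nat.Partrec.Code.evaln_complete c (Encodable.encode a) (Encodable.encode b)
    simp only [Option.mem_def] at this
    rw [← this, hc]
    simp

/-- The matrix must stay primitive recursive, so the value of `f` is guessed and verified through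
its graph. -/
theorem SigOne.comp {P : α → Prop} {f : β → α} (h : SigOne P) (hf : Computable f) :
    SigOne fun b => P (f b) := by
  exact ((SigOne.graph hf.partrec).and (h.comp_primrec Primrec.snd)).ex.of_iff fun b => by simp

theorem SigOne.dom {f : α →. β} (hf : Partrec f) : SigOne fun a => (f a).Dom :=
  (SigOne.graph hf).ex.of_iff fun _ => Part.dom_iff_mem

/-! ### `SigTwo` -/

theorem SigTwo.comp {P : α → Prop} {f : β → α} (h : SigTwo P) (hf : Computable f) :
    SigTwo fun b => P (f b) := by
  obtain ⟨R, hR, e⟩ := h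
  exact ⟨fun p => R (f p.1, p.2),
    hR.comp (Computable.pair (hf.comp Computable.fst) Computable.snd), fun b => e (f b)⟩

theorem SigTwo.of_not {P : α → Prop} (h : SigOne P) : SigTwo fun a => ¬ P a :=
  ⟨fun p => P p.1, h.comp_primrec Primrec.fst, fun a => by simp⟩

theorem SigOne.sigTwo {P : α → Prop} (h : SigOne P) : SigTwo P := by
  obtain ⟨R, hR, e⟩ := h
  exact ⟨fun p => ¬ R p, .of_primrec hR.not, fun a => by simp [e]⟩

theorem SigTwo.and {P Q : α → Prop} (hP : SigTwo P) (hQ : SigTwo Q) :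
    SigTwo fun a => P a ∧ Q a := by
  obtain ⟨R, hR, e⟩ := hP
  obtain ⟨R', hR', e'⟩ := hQ
  have h1 : Primrec fun p : α × ℕ => (p.1, p.2.unpair.1) :=
    Primrec.pair Primrec.fst (Primrec.fst.comp (Primrec.unpair.comp Primrec.snd))
  have h2 : Primrec fun p : α × ℕ => (p.1, p.2.unpair.2) :=
    Primrec.pair Primrec.fst (Primrec.snd.comp (Primrec.unpair.comp Primrec.snd))
  refine ⟨_, (hR.comp_primrec h1).or (hR'.comp_primrec h2), fun a => ?_⟩
  refine (and_congr (e a) (e' a)).trans ?_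
  constructor
  · rintro ⟨⟨y, hy⟩, z, hz⟩
    exact ⟨Nat.pair y z, by simpa using ⟨hy, hz⟩⟩
  · rintro ⟨y, hy⟩
    rw [not_or] at hy
    exact ⟨⟨_, hy.1⟩, _, hy.2⟩

theorem SigTwo.or {P Q : α → Prop} (hP : SigTwo P) (hQ : SigTwo Q) :
    SigTwo fun a => P a ∨ Q a := by
  obtain ⟨R, hR, e⟩ := hP
  obtain ⟨R', hR', e'⟩ := hQ
  refine ⟨_, hR.and hR', fun a => ?_⟩
  refine (or_congr (e a) (e' a)).trans ?_
  simp only [not_and_or, exists_or]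

theorem SigTwo.ex {P : α × β → Prop} (h : SigTwo P) : SigTwo fun a => ∃ b, P (a, b) := by
  obtain ⟨R, hR, e⟩ := h
  have h0 : Primrec fun p : α × ℕ => (Encodable.decode p.2.unpair.1 : Option β) :=
    Primrec.decode.comp (Primrec.fst.comp (Primrec.unpair.comp Primrec.snd))
  have h1 : Primrec fun p : (α × ℕ) × β => ((p.1.1, p.2), p.1.2.unpair.2) :=
    Primrec.pair (Primrec.pair (Primrec.fst.comp Primrec.fst) Primrec.snd)
      (Primrec.snd.comp (Primrec.unpair.comp (Primrec.snd.comp Primrec.fst)))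
  -- This predicate gets negated, so a number that decodes to nothing must satisfy it in order to be
  -- rejected as a witness.
  refine ⟨fun p => (Encodable.decode p.2.unpair.1 : Option β) = none ∨
      ∃ b : β, (Encodable.decode p.2.unpair.1 : Option β) = some b ∧
        R ((p.1, b), p.2.unpair.2), ?_, fun a => ?_⟩
  · refine (SigOne.of_primrec (Primrec.eq.comp h0 (Primrec.const none))).or ?_
    exact ((SigOne.of_primrec (Primrec.eq.comp (h0.comp Primrec.fst)
      (Primrec.option_some.comp Primrec.snd))).and (hR.comp_primrec h1)).ex
  · constructor
    · rintro ⟨b, hb⟩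
      obtain ⟨y, hy⟩ := (e (a, b)).1 hb
      exact ⟨Nat.pair (Encodable.encode b) y, by simpa using hy⟩
    · rintro ⟨y, hb⟩
      rw [not_or] at hb
      obtain ⟨b, hb'⟩ := Option.ne_none_iff_exists'.1 hb.1
      exact ⟨b, (e (a, b)).2 ⟨_, fun h => hb.2 ⟨b, hb', h⟩⟩⟩

/-- One list holds a witness for each `i < f a`; for a fixed list what remains is the negation of a
`SigOne` condition. -/
theorem SigTwo.ball {P : α → ℕ → Prop} {f : α → ℕ} (h : SigTwo fun p : α × ℕ => P p.1 p.2)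
    (hf : Primrec f) : SigTwo fun a => ∀ i < f a, P a i := by
  obtain ⟨R, hR, e⟩ := h
  have h1 : SigTwo fun p : α × List ℕ => ∀ i < f p.1, ¬ R ((p.1, i), p.2.getD i 0) := by
    have h2 : SigOne fun q : (α × List ℕ) × ℕ =>
        q.2 < f q.1.1 ∧ R ((q.1.1, q.2), q.1.2.getD q.2 0) := by
      refine (SigOne.of_primrec (Primrec.nat_lt.comp Primrec.snd
        (hf.comp (Primrec.fst.comp Primrec.fst)))).and (hR.comp_primrec ?_)
      exact Primrec.pair (Primrec.pair (Primrec.fst.comp Primrec.fst) Primrec.snd)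
        ((Primrec.list_getD 0).comp (Primrec.snd.comp Primrec.fst) Primrec.snd)
    exact (SigTwo.of_not h2.ex).of_iff fun p => by simp
  refine h1.ex.of_iff fun a => ?_
  constructor
  · intro H
    choose g hg using fun i => fun hi => (e (a, i)).1 (H i hi)
    refine ⟨(List.range (f a)).map fun i => if hi : i < f a then g i hi else 0, fun i hi => ?_⟩
    simpa [hi, List.getD] using hg i hi
  · rintro ⟨l, hl⟩ i hi
    exact (e (a, i)).2 ⟨_, hl i hi⟩

theorem SigTwo.isSigmaZeroTwo {S : Set ℕ} (h : SigTwo fun n => n ∈ S) : IsSigmaZeroTwo S := by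
  obtain ⟨Q, ⟨R, hR, e⟩, e'⟩ := h
  refine ⟨fun p => ¬ R ((p.1, p.2.1), p.2.2), PrimrecPred.computablePred (hR.comp ?_).not,
    fun n => ?_⟩
  · exact Primrec.pair (Primrec.pair Primrec.fst (Primrec.fst.comp Primrec.snd))
      (Primrec.snd.comp Primrec.snd)
  · simp [e', e]

end Arithmetical

/-! ### Saturated tuples in linear orderings -/

section Paths

/-- A path from `x` to `y` through the points `a` whose successive steps satisfy `Q g`, where `g`
runs through the word `w`. -/
inductive Path {X B : Type} (ι : X → B) (Q : Bool → B → B → Prop) :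
    B → List Bool → List X → B → Prop
  | single {x g y} : Q g x y → Path ι Q x [g] [] y
  | cons {x g z w a y} : Q g x (ι z) → Path ι Q (ι z) w a y → Path ι Q x (g :: w) (z :: a) y

theorem Path.append {X B : Type} {ι : X → B} {Q : Bool → B → B → Prop} {x y : B} {z : X}
    {w w' : List Bool} {a a' : List X} {y' : B} (h : Path ι Q x w a y') (hy : y' = ι z)
    (h' : Path ι Q (ι z) w' a' y) : Path ι Q x (w ++ w') (a ++ z :: a') y := by
  induction h with
  | single hQ => subst hy; exact .cons hQ h'
  | cons hQ _ ih => exact .cons hQ (ih hy)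

variable {X : Type} [LinearOrder X]

/-- A linear ordering with endpoints added. -/
abbrev Ends (X : Type) : Type := WithBot (WithTop X)

/-- The inclusion of a linear ordering into its extension by endpoints. -/
def toEnds (x : X) : Ends X := ((x : WithTop X) : WithBot (WithTop X))

theorem toEnds_lt {x y : X} : toEnds x < toEnds y ↔ x < y := by simp [toEnds]

theorem exists_toEnds {b : Ends X} (h : ⊥ < b) (h' : b < ⊤) : ∃ x : X, toEnds x = b := by
  induction b using WithBot.recBotCoe with
  | bot => simp at h
  | coe b =>
    induction b using WithTop.recTopCoe with
    | top => exact absurd h' (lt_irrefl _)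
    | coe b => exact ⟨b, rfl⟩

theorem bot_lt_toEnds (x : X) : ⊥ < toEnds x := WithBot.bot_lt_coe _

theorem toEnds_lt_top (x : X) : toEnds x < ⊤ := WithBot.coe_lt_coe.2 (WithTop.coe_lt_top x)

theorem exists_toEnds_of_mem_Ioo {x y b : Ends X} (h : b ∈ Set.Ioo x y) : ∃ z : X, toEnds z = b :=
  exists_toEnds (bot_le.trans_lt h.1) (h.2.trans_le le_top)

/-- The interval between two points is infinite (`true`) or empty (`false`). -/
def Gap (g : Bool) (x y : Ends X) : Prop :=
  x < y ∧ (g = true → (Set.Ioo x y).Infinite) ∧ (g = false → Set.Ioo x y = ∅)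

/-- A finite interval splits at any interior point into two with fewer points, until all gaps are
empty. -/
theorem exists_path_of_finite (n : ℕ) {x y : Ends X} (hxy : x < y) (hf : (Set.Ioo x y).Finite)
    (hn : (Set.Ioo x y).ncard < n) :
    ∃ w a, Path toEnds Gap x w a y ∧ ∀ z : X, toEnds z ∈ Set.Ioo x y → z ∈ a := by
  induction n generalizing x y with
  | zero => simp at hn
  | succ n ih =>
    rcases Set.eq_empty_or_nonempty (Set.Ioo x y) with he | ⟨b, hb⟩
    · exact ⟨[false], [], .single ⟨hxy, by simp, fun _ => he⟩, by simp [he]⟩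
    · obtain ⟨z, rfl⟩ := exists_toEnds_of_mem_Ioo hb
      have h1 : Set.Ioo x (toEnds z) ⊂ Set.Ioo x y :=
        ⟨Set.Ioo_subset_Ioo_right hb.2.le, fun h => lt_irrefl _ (h hb).2⟩
      have h2 : Set.Ioo (toEnds z) y ⊂ Set.Ioo x y :=
        ⟨Set.Ioo_subset_Ioo_left hb.1.le, fun h => lt_irrefl _ (h hb).1⟩
      obtain ⟨w, a, hp, ha⟩ := ih hb.1 (hf.subset h1.1)
        ((Set.ncard_lt_ncard h1 hf).trans_le (Nat.lt_succ_iff.1 hn))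
      obtain ⟨w', a', hp', ha'⟩ := ih hb.2 (hf.subset h2.1)
        ((Set.ncard_lt_ncard h2 hf).trans_le (Nat.lt_succ_iff.1 hn))
      refine ⟨_, _, hp.append rfl hp', fun t ht => ?_⟩
      rcases lt_trichotomy t z with h | h | h
      · simp [ha t ⟨ht.1, toEnds_lt.2 h⟩]
      · simp [h]
      · simp [ha' t ⟨toEnds_lt.2 h, ht.2⟩]

/-- Split at the prescribed points. An interval without prescribed points is a single gap if it is
infinite; if it is finite, all gaps in it can be made empty by adding points. -/
theorem exists_path (F : Finset X) {x y : Ends X} (hxy : x < y)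
    (hF : ∀ z ∈ F, toEnds z ∈ Set.Ioo x y) :
    ∃ w a, Path toEnds Gap x w a y ∧ ∀ z ∈ F, z ∈ a := by
  induction F using Finset.strongInduction generalizing x y with
  | H F ih =>
    rcases F.eq_empty_or_nonempty with rfl | ⟨z, hz⟩
    · by_cases hf : (Set.Ioo x y).Finite
      · obtain ⟨w, a, hp, -⟩ := exists_path_of_finite _ hxy hf (Nat.lt_succ_self _)
        exact ⟨w, a, hp, by simp⟩
      · exact ⟨[true], [], .single ⟨hxy, fun _ => hf, by simp⟩, by simp⟩
    · have h1 : F.filter (· < z) ⊂ F :=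
        ⟨Finset.filter_subset _ _, fun h => lt_irrefl z (Finset.mem_filter.1 (h hz)).2⟩
      have h2 : F.filter (z < ·) ⊂ F :=
        ⟨Finset.filter_subset _ _, fun h => lt_irrefl z (Finset.mem_filter.1 (h hz)).2⟩
      obtain ⟨w, a, hp, ha⟩ := ih _ h1 (hF z hz).1 fun t ht =>
        ⟨(hF t (h1.1 ht)).1, toEnds_lt.2 (Finset.mem_filter.1 ht).2⟩
      obtain ⟨w', a', hp', ha'⟩ := ih _ h2 (hF z hz).2 fun t ht =>
        ⟨toEnds_lt.2 (Finset.mem_filter.1 ht).2, (hF t (h2.1 ht)).2⟩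
      refine ⟨_, _, hp.append rfl hp', fun t ht => ?_⟩
      rcases lt_trichotomy t z with h | h | h
      · simp [ha t (by simp [ht, h])]
      · simp [h]
      · simp [ha' t (by simp [ht, h])]

theorem Path.finite_Ioo {x y : Ends X} {w : List Bool} {a : List X}
    (h : Path toEnds Gap x w a y) (hw : true ∉ w) : (Set.Ioo x y).Finite := by
  induction h with
  | @single x g y h =>
    cases g
    · simp [h.2.2 rfl]
    · simp at hw
  | @cons x g z w a y h _ ih =>
    cases g
    · refine ((ih (by simpa using hw)).union (Set.finite_singleton (toEnds z))).subset
        fun t ht => ?_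
      rcases lt_trichotomy t (toEnds z) with h' | h' | h'
      · have : t ∈ Set.Ioo x (toEnds z) := ⟨ht.1, h'⟩
        simp [h.2.2 rfl] at this
      · exact .inr h'
      · exact .inl ⟨h', ht.2⟩
    · simp at hw

/-- If all gaps were empty, the ordering would be finite. This is what allows realized words to be
written in the form `wordOf t`. -/
theorem Path.true_mem [Infinite X] {w : List Bool} {a : List X}
    (h : Path toEnds Gap (⊥ : Ends X) w a ⊤) : true ∈ w := by
  by_contra hw
  refine Set.infinite_range_of_injective (f := toEnds (X := X)) ?_
    ((h.finite_Ioo hw).subset ?_)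
  · exact (show StrictMono (toEnds (X := X)) from fun a b => toEnds_lt.2).injective
  · rintro _ ⟨x, rfl⟩
    exact ⟨bot_lt_toEnds x, toEnds_lt_top x⟩

/-- The words of the paths between two points. -/
def PathWord (x : Ends X) (w : List Bool) (y : Ends X) : Prop :=
  ∃ a, Path toEnds Gap x w a y

theorem pathWord_cons {x y : Ends X} {g : Bool} {w : List Bool} (hw : w ≠ []) :
    PathWord x (g :: w) y ↔ ∃ z : X, Gap g x (toEnds z) ∧ PathWord (toEnds z) w y := by
  constructor
  · rintro ⟨a, h⟩
    cases h with
    | single => exact absurd rfl hw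
    | cons h h' => exact ⟨_, h, _, h'⟩
  · rintro ⟨z, h, a, h'⟩
    exact ⟨_, .cons h h'⟩

theorem pathWord_singleton {x y : Ends X} {g : Bool} : PathWord x [g] y ↔ Gap g x y := by
  constructor
  · rintro ⟨a, h⟩
    cases h with
    | single h => exact h
    | cons _ h => cases h
  · exact fun h => ⟨_, .single h⟩

theorem gap_true_of {g h : Bool} {x y z : Ends X} (hg : Gap g x z) (hh : Gap h z y)
    (hgh : g = true ∨ h = true) : Gap true x y := by
  refine ⟨hg.1.trans hh.1, fun _ => ?_, by simp⟩
  rcases hgh with rfl | rfl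
  · exact (hg.2.1 rfl).mono (Set.Ioo_subset_Ioo_right hh.1.le)
  · exact (hh.2.1 rfl).mono (Set.Ioo_subset_Ioo_left hg.1.le)

/-- Deleting the point between the gaps `g` and `h` joins them into one gap, infinite because one of
them was. -/
theorem PathWord.erase {x y : Ends X} {u v : List Bool} {g h : Bool}
    (H : PathWord x (u ++ g :: h :: v) y) (hgh : g = true ∨ h = true) :
    PathWord x (u ++ true :: v) y := by
  induction u generalizing x with
  | nil =>
    rw [List.nil_append, pathWord_cons (by simp)] at H
    obtain ⟨z, hz, H⟩ := H
    rw [List.nil_append]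
    rcases eq_or_ne v [] with rfl | hv
    · rw [pathWord_singleton] at H ⊢
      exact gap_true_of hz H hgh
    · rw [pathWord_cons hv] at H ⊢
      obtain ⟨t, ht, H⟩ := H
      exact ⟨t, gap_true_of hz ht hgh, H⟩
  | cons c u ih =>
    rw [List.cons_append, pathWord_cons (by simp)] at H ⊢
    obtain ⟨z, hz, H⟩ := H
    exact ⟨z, hz, ih H⟩

end Paths

/-! ### Words with an infinite gap and Higman's lemma -/

section Words

/-- The word `0^n 1` for each entry `n` of the list. -/
def blocks (l : List ℕ) : List Bool := l.flatMap fun n => List.replicate n false ++ [true]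

/-- The word `0^p 1 0^{l_1} 1 … 1 0^{l_m} 1 0^q`. -/
def wordOf (t : ℕ × List ℕ × ℕ) : List Bool :=
  List.replicate t.1 false ++ true :: (blocks t.2.1 ++ List.replicate t.2.2 false)

theorem exists_wordOf {w : List Bool} (hw : true ∈ w) : ∃ t, wordOf t = w := by
  induction w with
  | nil => simp at hw
  | cons g w ih =>
    cases g
    · obtain ⟨⟨p, l, q⟩, rfl⟩ := ih (by simpa using hw)
      exact ⟨(p + 1, l, q), by simp [wordOf, List.replicate_succ]⟩
    · by_cases h : true ∈ w
      · obtain ⟨⟨p, l, q⟩, rfl⟩ := ih h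
        exact ⟨(0, p :: l, q), by simp [wordOf, blocks]⟩
      · refine ⟨(0, [], w.length), ?_⟩
        have : w = List.replicate w.length false :=
          List.eq_replicate_of_mem fun b hb => by cases b <;> simp_all
        simp [wordOf, blocks, ← this]

/-- The product of the orders of `ℕ`, of lists with the Higman order, and of `ℕ`. -/
def TripleLE (s t : ℕ × List ℕ × ℕ) : Prop :=
  s.1 ≤ t.1 ∧ List.SublistForall₂ (· ≤ ·) s.2.1 t.2.1 ∧ s.2.2 ≤ t.2.2

/-- Closure of a set of words under merging a gap with an adjacent infinite gap. -/
def MergeClosed (V : List Bool → Prop) : Prop :=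
  ∀ u v g h, (g = true ∨ h = true) → V (u ++ g :: h :: v) → V (u ++ true :: v)

theorem MergeClosed.drop_left {V : List Bool → Prop} (hV : MergeClosed V) {u v : List Bool}
    (k : ℕ) (h : V (u ++ (List.replicate k false ++ true :: v))) : V (u ++ true :: v) := by
  induction k with
  | zero => simpa using h
  | succ k ih =>
    refine ih ?_
    rw [List.replicate_succ', List.append_assoc, List.singleton_append] at h
    rw [← List.append_assoc] at h ⊢
    exact hV _ _ _ _ (.inr rfl) h

theorem MergeClosed.drop_right {V : List Bool → Prop} (hV : MergeClosed V) {u v : List Bool}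
    (k : ℕ) (h : V (u ++ true :: (List.replicate k false ++ v))) : V (u ++ true :: v) := by
  induction k with
  | zero => simpa using h
  | succ k ih =>
    refine ih ?_
    rw [List.replicate_succ, List.cons_append] at h
    exact hV _ _ _ _ (.inl rfl) h

/-- The infinite gap in front of the block absorbs first its empty gaps and then its final infinite
gap. -/
theorem MergeClosed.drop_block {V : List Bool → Prop} (hV : MergeClosed V) {u v : List Bool}
    {n : ℕ} {l : List ℕ} (h : V (u ++ true :: (blocks (n :: l) ++ v))) :
    V (u ++ true :: (blocks l ++ v)) := by
  have : blocks (n :: l) ++ v = List.replicate n false ++ true :: (blocks l ++ v) := by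
    simp [blocks]
  rw [this] at h
  exact hV _ _ _ _ (.inl rfl) (hV.drop_right n h)

/-- An omitted block is absorbed by the infinite gap before it; in a block that is kept, the surplus
empty gaps are absorbed by the infinite gap that ends it. -/
theorem MergeClosed.blocks {V : List Bool → Prop} (hV : MergeClosed V) {l' l : List ℕ}
    (hl : List.SublistForall₂ (· ≤ ·) l' l) {u v : List Bool}
    (h : V (u ++ true :: (blocks l ++ v))) : V (u ++ true :: (EffStr.blocks l' ++ v)) := by
  induction hl generalizing u with
  | @nil l =>
    induction l with
    | nil => exact h
    | cons n l ih => exact ih (hV.drop_block h)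
  | @cons n' n l' l hn _ ih =>
    have e : ∀ n l, u ++ true :: (EffStr.blocks (n :: l) ++ v) =
        (u ++ true :: List.replicate n false) ++ true :: (EffStr.blocks l ++ v) := by
      intro n l
      simp [EffStr.blocks]
    rw [e] at h ⊢
    refine ih ?_
    obtain ⟨k, rfl⟩ := Nat.exists_eq_add_of_le hn
    refine hV.drop_left k ?_
    rw [List.replicate_add] at h
    simpa only [List.append_assoc, List.cons_append] using h
  | cons_right _ ih => exact ih (hV.drop_block h)

theorem MergeClosed.of_tripleLE {V : List Bool → Prop} (hV : MergeClosed V)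
    {s t : ℕ × List ℕ × ℕ} (hst : TripleLE s t) (h : V (wordOf t)) : V (wordOf s) := by
  obtain ⟨p, l, q⟩ := s
  obtain ⟨p', l', q'⟩ := t
  obtain ⟨hp, hl, hq⟩ := hst
  obtain ⟨k, rfl⟩ := Nat.exists_eq_add_of_le hp
  obtain ⟨m, rfl⟩ := Nat.exists_eq_add_of_le hq
  have h1 : V (List.replicate p false ++ true :: (EffStr.blocks l' ++
      List.replicate (q + m) false)) := by
    refine hV.drop_left k ?_
    rw [wordOf, List.replicate_add] at h
    simpa only [List.append_assoc, List.cons_append] using h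
  have h2 := hV.blocks hl h1
  have e : EffStr.blocks l ++ List.replicate (q + m) false =
      EffStr.blocks l ++ List.replicate m false ++ List.replicate q false := by
    rw [Nat.add_comm q m, List.replicate_add, List.append_assoc]
  -- The surplus empty gaps at the end are absorbed by the last infinite gap, which is the leading
  -- one if there are no blocks and otherwise ends the last block.
  rcases List.eq_nil_or_concat l with rfl | ⟨l, n, rfl⟩
  · simp only [EffStr.blocks, List.flatMap_nil, List.nil_append] at e h2
    rw [e] at h2
    exact hV.drop_right m h2
  · have e' : ∀ z : List Bool, List.replicate p false ++ true :: (EffStr.blocks (l ++ [n]) ++ z) =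
        (List.replicate p false ++ true :: (EffStr.blocks l ++ List.replicate n false)) ++
          true :: z := by
      intro z
      simp [EffStr.blocks]
    simp only [List.concat_eq_append] at h2 e ⊢
    rw [e, List.append_assoc, e'] at h2
    have h3 := hV.drop_right m h2
    rw [← e'] at h3
    exact h3

/-! ### Higman's lemma and decidability of downward closed sets -/

theorem wellQuasiOrdered_tripleLE : WellQuasiOrdered TripleLE := by
  have h1 : WellQuasiOrdered ((· ≤ ·) : ℕ → ℕ → Prop) := wellQuasiOrdered_le
  have h2 : WellQuasiOrdered (List.SublistForall₂ ((· ≤ ·) : ℕ → ℕ → Prop)) := by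
    have := Set.PartiallyWellOrderedOn.partiallyWellOrderedOn_sublistForall₂ (· ≤ ·)
      (Set.partiallyWellOrderedOn_univ_iff.2 h1)
    simpa [Set.partiallyWellOrderedOn_univ_iff] using this
  have : IsPreorder (List ℕ) (List.SublistForall₂ ((· ≤ ·) : ℕ → ℕ → Prop)) := {}
  exact h1.prod (h2.prod h1)

/-- For a fixed left list, recurse along the right one: its head either matches the head of the left
list or is skipped. -/
theorem primrecPred_sublistForall₂ (l : List ℕ) :
    PrimrecPred fun l' => List.SublistForall₂ (· ≤ ·) l l' := by
  classical
  induction l with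
  | nil => exact (PrimrecPred.of_eq (p := fun _ : List ℕ => True) ⟨inferInstance, Primrec.const _⟩
      fun l' => by simp [List.SublistForall₂.nil])
  | cons n l ih =>
    obtain ⟨_, ih⟩ := ih
    have h : Primrec fun l' : List ℕ => (List.rec (motive := fun _ => Bool) false
        (fun m l' b => (decide (n ≤ m) && decide (List.SublistForall₂ (· ≤ ·) l l')) || b) l') := by
      refine Primrec.list_rec Primrec.id (Primrec.const false) (h := fun _ p =>
        (decide (n ≤ p.1) && decide (List.SublistForall₂ (· ≤ ·) l p.2.1)) || p.2.2) ?_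
      refine Primrec.or.comp (Primrec.and.comp
        ((Primrec.nat_le.comp (Primrec.const n) (Primrec.fst.comp Primrec.snd)).decide)
        ((ih.of_eq fun _ => by congr).comp
          (Primrec.fst.comp (Primrec.snd.comp Primrec.snd)))) ?_
      exact Primrec.snd.comp (Primrec.snd.comp Primrec.snd)
    refine ⟨Classical.decPred _, h.of_eq fun l' => ?_⟩
    induction l' with
    | nil =>
      have : ¬ List.SublistForall₂ (· ≤ ·) (n :: l) [] := by rintro ⟨⟩
      simp [this]
    | cons m l' ih' =>
      have : List.SublistForall₂ (· ≤ ·) (n :: l) (m :: l') ↔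
          (n ≤ m ∧ List.SublistForall₂ (· ≤ ·) l l') ∨
            List.SublistForall₂ (· ≤ ·) (n :: l) l' := by
        constructor
        · intro h
          cases h with
          | cons h1 h2 => exact .inl ⟨h1, h2⟩
          | cons_right h => exact .inr h
        · rintro (⟨h1, h2⟩ | h)
          · exact .cons h1 h2
          · exact .cons_right h
      simp [ih', this]

/-- The complement is upward closed, hence generated by a finite set `F`: otherwise one could keep
choosing elements outside `D` that lie above no earlier choice, a bad sequence. Membership in `D` is
then a finite comparison with `F`. -/
theorem primrecPred_of_tripleLE_closed {D : ℕ × List ℕ × ℕ → Prop}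
    (hD : ∀ s t, TripleLE s t → D t → D s) : PrimrecPred D := by
  classical
  obtain ⟨F, hF, hF'⟩ : ∃ F : Finset (ℕ × List ℕ × ℕ), (∀ f ∈ F, ¬ D f) ∧
      ∀ t, ¬ D t → ∃ f ∈ F, TripleLE f t := by
    by_contra! H
    obtain ⟨f, -, hf⟩ := exists_seq_of_forall_finset_exists (fun t => ¬ D t)
      (fun s t => ¬ TripleLE s t) H
    obtain ⟨m, n, hmn, h⟩ := wellQuasiOrdered_tripleLE f
    exact hf m n hmn h
  have h1 : PrimrecPred fun t => ∀ f ∈ F, ¬ TripleLE f t := by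
    clear hF hF'
    induction F using Finset.induction with
    | empty => exact (PrimrecPred.of_eq (p := fun _ => True) ⟨inferInstance, Primrec.const _⟩
        fun l' => by simp)
    | insert f F _ ih =>
      have : PrimrecPred fun t => TripleLE f t :=
        (Primrec.nat_le.comp (Primrec.const f.1) Primrec.fst).and
          (((primrecPred_sublistForall₂ f.2.1).comp (Primrec.fst.comp Primrec.snd)).and
            (Primrec.nat_le.comp (Primrec.const f.2.2) (Primrec.snd.comp Primrec.snd)))
      exact (this.not.and ih).of_eq fun t => by simp
  refine h1.of_eq fun t => ⟨fun h => ?_, fun h f hf hft => hF f hf (hD f t hft h)⟩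
  by_contra ht
  obtain ⟨f, hf, hft⟩ := hF' t ht
  exact h f hf hft

theorem primrec_wordOf : Primrec wordOf := by
  have hr : Primrec fun n : ℕ => List.replicate n false := by
    have : Primrec fun n : ℕ => (List.range n).map fun _ => false :=
      Primrec.list_map Primrec.list_range (Primrec.const false).to₂
    exact this.of_eq fun n => by simp
  have hb : Primrec blocks :=
    Primrec.list_flatMap Primrec.id
      (Primrec.list_concat.comp (hr.comp Primrec.snd) (Primrec.const true)).to₂
  exact Primrec.list_append.comp (hr.comp Primrec.fst) (Primrec.list_cons.comp (Primrec.const true)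
    (Primrec.list_append.comp (hb.comp (Primrec.fst.comp Primrec.snd))
      (hr.comp (Primrec.snd.comp Primrec.snd))))

/-- The words of the saturated tuples in an infinite linear ordering are computably enumerable. -/
theorem sigOne_pathWord {X : Type} [LinearOrder X] [Infinite X] :
    SigOne fun w => PathWord (⊥ : Ends X) w ⊤ := by
  have hV : MergeClosed fun w => PathWord (⊥ : Ends X) w ⊤ := fun u v g h hgh H => H.erase hgh
  have h1 : SigOne fun p : List Bool × (ℕ × List ℕ × ℕ) =>
      PathWord (⊥ : Ends X) (wordOf p.2) ⊤ ∧ wordOf p.2 = p.1 :=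
    (SigOne.of_primrec ((primrecPred_of_tripleLE_closed
      fun s t hst => hV.of_tripleLE hst).comp Primrec.snd)).and
      (SigOne.of_primrec (Primrec.eq.comp (primrec_wordOf.comp Primrec.snd) Primrec.fst))
  refine h1.ex.of_iff fun w => ⟨?_, ?_⟩
  · rintro ⟨a, h⟩
    obtain ⟨t, rfl⟩ := exists_wordOf h.true_mem
    exact ⟨t, ⟨a, h⟩, rfl⟩
  · rintro ⟨t, h, e⟩
    exact (show wordOf t = w from e) ▸ h

end Words

/-! ### Truth of computable `Σ₁` formulas at saturated tuples -/

section Truth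

/-- A linear ordering of `ℕ`, not to be confused with the usual one by instance search. -/
def NatOrdering : Type := LinearOrder ℕ

/-- A linear ordering of `ℕ` as an ordered type. -/
def Carrier (_ : NatOrdering) : Type := ℕ

instance (L : NatOrdering) : LinearOrder (Carrier L) := id (α := LinearOrder ℕ) L

instance (L : NatOrdering) : Infinite (Carrier L) := inferInstanceAs (Infinite ℕ)

/-- The relation of a linear ordering of `ℕ`. -/
def NatOrdering.Lt (L : NatOrdering) (x y : ℕ) : Prop := @LT.lt (Carrier L) _ x y

/-- A linear ordering of `ℕ` as a structure. -/
abbrev NatOrdering.struc (L : NatOrdering) : Struc binarySignature := binaryStruc L.Lt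

/-- The usual ordering of `ℕ`. -/
abbrev natOrder : Struc binarySignature := binaryStruc (· < ·)

/-- Quantifier-free truth depends only on the atomic type of the tuple, so `f` need respect equality
and the relation only among its entries. Well-formedness keeps the default value of `getD` out of
play. -/
theorem holds_map_iff {r r' : ℕ → ℕ → Prop} {f : ℕ → ℕ} {x : List ℕ}
    (hf : ∀ a ∈ x, ∀ b ∈ x, (a = b ↔ f a = f b) ∧ (r a b ↔ r' (f a) (f b)))
    {θ : QFree binarySignature} (hθ : θ.WF x.length) :
    θ.Holds (binaryStruc r) x ↔ θ.Holds (binaryStruc r') (x.map f) := by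
  have hg : ∀ i < x.length, (x.map f).getD i 0 = f (x.getD i 0) := fun i hi => by
    simp [List.getD, hi]
  have hm : ∀ i < x.length, x.getD i 0 ∈ x := fun i hi => by
    simp [List.getD, hi]
  have hA : ∀ at' : Atom binarySignature, at'.WF x.length →
      (at'.Holds (binaryStruc r) x ↔ at'.Holds (binaryStruc r') (x.map f)) := by
    rintro (⟨i, j⟩ | ⟨s, v⟩) hw
    · obtain ⟨hi, hj⟩ := hw
      simp only [Atom.Holds, hg i hi, hg j hj]
      exact (hf _ (hm i hi) _ (hm j hj)).1
    · obtain ⟨hl, hv⟩ := hw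
      obtain ⟨i, j, rfl⟩ := List.length_eq_two.1 hl
      simp only [List.mem_cons, List.not_mem_nil, or_false, forall_eq_or_imp, forall_eq] at hv
      simp only [Atom.Holds, List.map_cons, List.map_nil, hg i hv.1, hg j hv.2, binaryStruc,
        List.cons.injEq, and_true]
      have := (hf _ (hm i hv.1) _ (hm j hv.2)).2
      constructor
      · rintro ⟨a, b, ⟨rfl, rfl⟩, h⟩
        exact ⟨_, _, ⟨rfl, rfl⟩, this.1 h⟩
      · rintro ⟨a, b, ⟨rfl, rfl⟩, h⟩
        exact ⟨_, _, ⟨rfl, rfl⟩, this.2 h⟩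
  refine exists_congr fun C => and_congr_right fun hC => forall₂_congr fun l hl => ?_
  simp only [Literal.Holds, hA l.2 (hθ C hC l hl)]

/-- Steps in `ℕ` along which nothing is skipped if the gap is empty. -/
def NatStep (g : Bool) (m n : ℕ) : Prop := m < n ∧ (g = false → n = m + 1)

theorem Path.length_eq {X B : Type} {ι : X → B} {Q : Bool → B → B → Prop} {x y : B}
    {w : List Bool} {a : List X} (h : Path ι Q x w a y) : w.length = a.length + 1 := by
  induction h with
  | single => rfl
  | cons _ _ ih => simp [ih]

theorem Path.natStep_lt {m n : ℕ} {w : List Bool} {a : List ℕ} (h : Path id NatStep m w a n) :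
    m < n ∧ ∀ z ∈ a, m < z ∧ z < n := by
  induction h with
  | single h => exact ⟨h.1, by simp⟩
  | cons h _ ih =>
    refine ⟨h.1.trans ih.1, ?_⟩
    simp only [List.mem_cons, forall_eq_or_imp]
    exact ⟨⟨h.1, ih.1⟩, fun z hz => ⟨h.1.trans (ih.2 z hz).1, (ih.2 z hz).2⟩⟩

/-- Replaces the inductive definition by a bounded quantifier, for the sake of primitive
recursiveness. The lists `m :: (a ++ [n])` and `a ++ [n]` supply the left and right ends of the
steps. -/
theorem path_natStep_iff {m n : ℕ} {w : List Bool} {a : List ℕ} :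
    Path id NatStep m w a n ↔ w.length = a.length + 1 ∧ ∀ i < w.length,
      NatStep (w.getD i true) ((m :: (a ++ [n])).getD i 0) ((a ++ [n]).getD i 0) := by
  induction w generalizing m a with
  | nil =>
    constructor
    · rintro ⟨⟩
    · simp
  | cons g w ih =>
    cases a with
    | nil =>
      constructor
      · rintro (h | _)
        simpa using h
      · rintro ⟨h, h'⟩
        obtain rfl : w = [] := by simpa using h
        exact .single (by simpa using h')
    | cons z a =>
      constructor
      · rintro (_ | ⟨h, h'⟩)
        obtain ⟨h1, h2⟩ := ih.1 h'
        refine ⟨by simp [h1], fun i hi => ?_⟩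
        cases i with
        | zero => simpa using h
        | succ i => simpa using h2 i (by simpa using hi)
      · rintro ⟨h, h'⟩
        refine .cons (by simpa using h' 0 (by simp)) (ih.2 ⟨by simpa using h, fun i hi => ?_⟩)
        simpa using h' (i + 1) (by simpa using hi)

/-! ### Passing between saturated tuples and positions in `ℕ` -/

section Transfer

variable {X : Type} [LinearOrder X]

open Classical in
/-- The number of elements of `C` below `z`. -/
noncomputable def rank (C : Finset (Ends X)) (z : Ends X) : ℕ := (C.filter (· < z)).card

theorem rank_lt {C : Finset (Ends X)} {x y : Ends X} (hx : x ∈ C) (h : x < y) :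
    rank C x < rank C y := by
  classical
  refine Finset.card_lt_card ⟨fun z hz => ?_, fun H => ?_⟩
  · rw [Finset.mem_filter] at hz ⊢
    exact ⟨hz.1, hz.2.trans h⟩
  · exact lt_irrefl x (Finset.mem_filter.1 (H (Finset.mem_filter.2 ⟨hx, h⟩))).2

theorem rank_eq_succ {C : Finset (Ends X)} {x y : Ends X} (hx : x ∈ C) (h : x < y)
    (he : Set.Ioo x y = ∅) : rank C y = rank C x + 1 := by
  classical
  have : C.filter (· < y) = insert x (C.filter (· < x)) := by
    ext z
    simp only [Finset.mem_filter, Finset.mem_insert]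
    constructor
    · rintro ⟨hz, hzy⟩
      rcases lt_trichotomy z x with h' | h' | h'
      · exact .inr ⟨hz, h'⟩
      · exact .inl h'
      · exact (Set.eq_empty_iff_forall_notMem.1 he z ⟨h', hzy⟩).elim
    · rintro (rfl | ⟨hz, hzx⟩)
      · exact ⟨hx, h⟩
      · exact ⟨hz, hzx.trans h⟩
  unfold rank
  rw [this, Finset.card_insert_of_notMem (by simp)]

/-- Rank strictly increases from a point of `C`, and by exactly one across an empty gap. Only left
ends of steps need to be in `C`, so the final endpoint may lie outside it. -/
theorem Path.map_rank {C : Finset (Ends X)} {x y : Ends X} {w : List Bool} {a : List X}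
    (h : Path toEnds Gap x w a y) (hx : x ∈ C) (ha : ∀ z ∈ a, toEnds z ∈ C) :
    Path id NatStep (rank C x) w (a.map fun z => rank C (toEnds z)) (rank C y) := by
  have hs : ∀ {g x y}, x ∈ C → Gap g x y → NatStep g (rank C x) (rank C y) :=
    fun hx hg => ⟨rank_lt hx hg.1, fun h => rank_eq_succ hx hg.1 (hg.2.2 h)⟩
  induction h with
  | single h => exact .single (hs hx h)
  | cons h _ ih =>
    simp only [List.mem_cons, forall_eq_or_imp] at ha
    exact .cons (hs hx h) (ih ha.1 ha.2)

theorem Gap.exists_strictMono {g : Bool} {x y : Ends X} {m n : ℕ} (h : Gap g x y)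
    (h' : NatStep g m n) : ∃ f : ℕ → Ends X, f m = x ∧ f n = y ∧
      ∀ i j, m ≤ i → i < j → j ≤ n → f i < f j := by
  cases g
  · obtain rfl := h'.2 rfl
    refine ⟨fun i => if i = m then x else y, by simp, by simp, fun i j hi hij hj => ?_⟩
    obtain rfl : i = m := by omega
    obtain rfl : j = i + 1 := by omega
    simpa using h.1
  -- There are `n - m - 1` positions strictly between `m` and `n`; the infinite gap supplies that
  -- many points.
  · obtain ⟨s, hs, hc⟩ := (h.2.1 rfl).exists_subset_card_eq (n - m - 1)
    let e := s.orderEmbOfFin hc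
    have he : ∀ i, x < e i ∧ e i < y := fun i => hs (s.orderEmbOfFin_mem hc i)
    refine ⟨fun i => if i = m then x else if hi : i - m - 1 < n - m - 1 then e ⟨_, hi⟩ else y,
      by simp, ?_, fun i j hi hij hj => ?_⟩
    · have := h'.1
      simp [this.ne']
    · have hj0 : j ≠ m := by omega
      rcases eq_or_ne i m with rfl | hi0
      · simp only [if_true, hj0, if_false]
        split_ifs
        · exact (he _).1
        · exact h.1
      · have hi' : i - m - 1 < n - m - 1 := by omega
        simp only [hi0, hj0, if_false, hi', dif_pos]
        split_ifs
        · refine e.strictMono ?_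
          rw [Fin.mk_lt_mk]
          omega
        · exact (he _).2

theorem Path.exists_strictMono {x y : Ends X} {m n : ℕ} {w : List Bool} {a : List X}
    {pos : List ℕ} (h : Path toEnds Gap x w a y) (h' : Path id NatStep m w pos n) :
    ∃ f : ℕ → Ends X, f m = x ∧ f n = y ∧ (∀ i j, m ≤ i → i < j → j ≤ n → f i < f j) ∧
      pos.map f = a.map toEnds := by
  induction h generalizing m pos with
  | single h =>
    cases h' with
    | single h' =>
      obtain ⟨f, h1, h2, h3⟩ := h.exists_strictMono h'
      exact ⟨f, h1, h2, h3, rfl⟩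
    | cons _ h' => cases h'
  | cons h hp ih =>
    cases h' with
    | single h' => cases hp
    | @cons _ _ k _ p _ h' hp' =>
      obtain ⟨f, h1, h2, h3⟩ := h.exists_strictMono h'
      obtain ⟨f', h1', h2', h3', h4'⟩ := ih hp'
      simp only [id] at h2 h3 h1' h3'
      have hk : k < n := hp'.natStep_lt.1
      have hmk : m < k := h'.1
      refine ⟨fun i => if i ≤ k then f i else f' i, by simp [hmk.le, h1], by simp [hk, h2'],
        fun i j hi hij hj => ?_, ?_⟩
      · rcases le_or_gt j k with hjk | hjk
        · simpa [hjk, hij.le.trans hjk] using h3 i j hi hij hjk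
        · have e : (if j ≤ k then f j else f' j) = f' j := if_neg (by omega)
          simp only [e]
          split_ifs with hik
          · have hf : f i ≤ f k := by
              rcases eq_or_lt_of_le hik with rfl | hik
              · exact le_rfl
              · exact (h3 i k hi hik le_rfl).le
            exact hf.trans_lt (h2.trans h1'.symm ▸ h3' k j le_rfl hjk hj)
          · exact h3' i j (by omega) hij hj
      · rw [List.map_cons, List.map_cons, if_pos le_rfl, h2, ← h4']
        congr 1
        refine List.map_congr_left fun z hz => if_neg ?_
        have := (hp'.natStep_lt.2 z hz).1
        simp only [id] at this
        omega

end Transfer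

/-- The truth of the computable `Σ₁` formula with index `e` at the points with indices `t` in a
saturated tuple with word `w`. -/
def WordHolds (w : List Bool) (n : ℕ) (e : Nat.Partrec.Code) (t : List ℕ) : Prop :=
  t.length = n ∧ ∃ (φ : Existential binarySignature) (T : ℕ) (pos b : List ℕ),
    InCE e φ ∧ QFree.WF (n + φ.1) φ.2 ∧ Path id NatStep 0 w pos T ∧ b.length = φ.1 ∧
      (∀ z ∈ b, 0 < z ∧ z < T) ∧ QFree.Holds natOrder (t.map (fun i => pos.getD i 0) ++ b) φ.2

theorem getElem_of_map_eq {α β γ : Type} {f : α → γ} {g : β → γ} {l : List α} {l' : List β}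
    (h : l.map f = l'.map g) {i : ℕ} (hi : i < l.length) (hi' : i < l'.length) :
    f l[i] = g l'[i] := by
  have := congrArg (fun l => l[i]?) h
  simpa [hi, hi'] using this

/-- From left to right, the tuple and the witnesses are replaced by their ranks in a finite set.
From right to left, positions in `ℕ` are embedded in the ordering, using the room in the infinite
gaps. Both maps preserve the order among the entries, hence quantifier-free truth. -/
theorem sigmaOneHolds_iff_wordHolds {L : NatOrdering} {w : List Bool} {a : List ℕ}
    (h : Path (X := Carrier L) toEnds Gap ⊥ w a ⊤) {n : ℕ} {e : Nat.Partrec.Code} {t : List ℕ}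
    (ht : ∀ i ∈ t, i < a.length) :
    SigmaOneHolds L.struc n e (t.map fun i => a.getD i 0) ↔ WordHolds w n e t := by
  classical
  have hlen : ∀ {pos : List ℕ} {T}, Path id NatStep 0 w pos T → pos.length = a.length := by
    intro pos T hp
    have h1 := hp.length_eq
    have h2 := h.length_eq
    exact Nat.succ_injective (h1.symm.trans h2)
  constructor
  · rintro ⟨hn, φ, hφ, hw, b, hb, hh⟩
    rw [List.length_map] at hn
    let ι : ℕ → Ends (Carrier L) := fun z => toEnds (X := Carrier L) z
    -- With `⊥` in `C`, the rank of `⊥` is `0` and all points of the ordering have positive rank.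
    let C : Finset (Ends (Carrier L)) := insert ⊥ ((a ++ b).toFinset.image ι)
    have hC : ∀ z ∈ a ++ b, ι z ∈ C := fun z hz =>
      Finset.mem_insert_of_mem (Finset.mem_image_of_mem _ (List.mem_toFinset.2 hz))
    have hbot : ⊥ ∈ C := Finset.mem_insert_self _ _
    let f : ℕ → ℕ := fun z => rank C (ι z)
    have hp := h.map_rank (C := C) hbot fun z hz => hC z (List.mem_append_left _ hz)
    have h0 : rank C ⊥ = 0 := by simp [rank]
    rw [h0] at hp
    refine ⟨hn, φ, _, _, b.map f, hφ, hw, hp, by simpa using hb, ?_, ?_⟩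
    · intro z hz
      obtain ⟨z, hz', rfl⟩ := List.mem_map.1 hz
      refine ⟨(Nat.zero_le _).trans_lt (rank_lt hbot (bot_lt_toEnds _)),
        rank_lt (hC z (List.mem_append_right _ hz')) (toEnds_lt_top _)⟩
    · have e1 : t.map (fun i => (a.map f).getD i 0) ++ b.map f =
          (t.map (fun i => a.getD i 0) ++ b).map f := by
        rw [List.map_append, List.map_map]
        congr 1
        refine List.map_congr_left fun i hi => ?_
        simp [List.getD, ht i hi]
      have hmem : ∀ z ∈ t.map (fun i => a.getD i 0) ++ b, ι z ∈ C := by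
        intro z hz
        rcases List.mem_append.1 hz with hz | hz
        · obtain ⟨i, hi, rfl⟩ := List.mem_map.1 hz
          refine hC _ (List.mem_append_left _ ?_)
          simp [List.getD, ht i hi]
        · exact hC _ (List.mem_append_right _ hz)
      have hlt : ∀ z ∈ t.map (fun i => a.getD i 0) ++ b, ∀ z', L.Lt z z' → f z < f z' :=
        fun z hz z' h => rank_lt (hmem z hz) (toEnds_lt (X := Carrier L).2 h)
      refine (e1 ▸ (holds_map_iff (r := L.Lt) (r' := (· < ·)) (f := f) (fun x hx y hy => ?_)
        (by simpa [hn, hb] using hw)).1 hh :)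
      rcases lt_trichotomy (α := Carrier L) x y with hxy | rfl | hxy
      · have := hlt x hx y hxy
        exact ⟨⟨fun e => e ▸ rfl, fun e => absurd e this.ne⟩, iff_of_true hxy this⟩
      · exact ⟨by simp, iff_of_false (lt_irrefl (α := Carrier L) x) (lt_irrefl _)⟩
      · have := hlt y hy x hxy
        exact ⟨⟨fun e => e ▸ rfl, fun e => absurd e this.ne'⟩,
          iff_of_false (lt_asymm (α := Carrier L) hxy) this.le.not_gt⟩
  · rintro ⟨hn, φ, T, pos, b, hφ, hw, hp, hb, hbT, hh⟩
    obtain ⟨f, hf0, hfT, hf, hfa⟩ := h.exists_strictMono hp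
    -- Positions strictly between `0` and `T` go to genuine points, not to the added endpoints;
    -- elsewhere the value is irrelevant.
    have hex : ∀ i, ∃ x : ℕ, 0 < i → i < T → toEnds (X := Carrier L) x = f i := by
      intro i
      by_cases hi : 0 < i ∧ i < T
      · obtain ⟨x, hx⟩ := exists_toEnds (hf0 ▸ hf 0 i le_rfl hi.1 hi.2.le)
          (hfT ▸ hf i T hi.1.le hi.2 le_rfl)
        exact ⟨x, fun _ _ => hx⟩
      · exact ⟨0, fun h1 h2 => absurd ⟨h1, h2⟩ hi⟩
    choose g hg using hex
    have hpos := hp.natStep_lt.2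
    have hinj : ∀ x y : Carrier L, toEnds x = toEnds y → x = y := fun x y h => by
      simpa [toEnds] using h
    have hmem : ∀ z ∈ t.map (fun i => pos.getD i 0) ++ b, 0 < z ∧ z < T := by
      intro z hz
      rcases List.mem_append.1 hz with hz | hz
      · obtain ⟨i, hi, rfl⟩ := List.mem_map.1 hz
        refine hpos _ ?_
        simp [List.getD, hlen hp, ht i hi]
      · exact hbT z hz
    have e1 : (t.map (fun i => pos.getD i 0) ++ b).map g =
        t.map (fun i => a.getD i 0) ++ b.map g := by
      rw [List.map_append, List.map_map]
      congr 1
      refine List.map_congr_left fun i hi => ?_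
      have hi' := ht i hi
      have hi'' : i < pos.length := hlen hp ▸ hi'
      have h1 : f pos[i] = toEnds (X := Carrier L) a[i] := getElem_of_map_eq hfa hi'' hi'
      have h2 := hpos _ (List.getElem_mem hi'')
      have h3 := hinj _ _ ((hg pos[i] h2.1 h2.2).trans h1)
      simp only [Function.comp, List.getD, List.getElem?_eq_getElem hi',
        List.getElem?_eq_getElem hi'', Option.getD_some]
      exact h3
    refine ⟨by simpa using hn, φ, hφ, hw, b.map g, by simpa using hb, ?_⟩
    refine (e1 ▸ (holds_map_iff (r := (· < ·)) (r' := L.Lt) (f := g) (fun x hx y hy => ?_)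
        (by simpa [hn, hb] using hw)).1 hh :)
    have hlt : ∀ x ∈ t.map (fun i => pos.getD i 0) ++ b,
        ∀ y ∈ t.map (fun i => pos.getD i 0) ++ b, x < y → L.Lt (g x) (g y) := by
      intro x hx y hy hxy
      refine toEnds_lt (X := Carrier L).1 ?_
      rw [hg x (hmem x hx).1 (hmem x hx).2, hg y (hmem y hy).1 (hmem y hy).2]
      exact hf x y (Nat.zero_le _) hxy (hmem y hy).2.le
    rcases lt_trichotomy x y with hxy | rfl | hxy
    · have := hlt x hx y hy hxy
      exact ⟨⟨fun e => e ▸ rfl, fun e => absurd e (ne_of_lt (α := Carrier L) this)⟩,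
        iff_of_true hxy this⟩
    · exact ⟨by simp, iff_of_false (lt_irrefl _) (lt_irrefl (α := Carrier L) _)⟩
    · have := hlt y hy x hx hxy
      exact ⟨⟨fun e => e ▸ rfl, fun e => absurd e.symm (ne_of_lt (α := Carrier L) this)⟩,
        iff_of_false hxy.le.not_gt (lt_asymm (α := Carrier L) this)⟩

end Truth

/-! ### Computability of truth -/

section Computability

variable {α β γ : Type} [Primcodable α] [Primcodable β] [Primcodable γ]

theorem primrecPred_sumElim {f : α → β ⊕ γ} {P : α → β → Prop} {Q : α → γ → Prop}
    (hf : Primrec f) (hP : PrimrecPred fun p : α × β => P p.1 p.2)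
    (hQ : PrimrecPred fun p : α × γ => Q p.1 p.2) :
    PrimrecPred fun a => Sum.elim (P a) (Q a) (f a) := by
  classical
  obtain ⟨_, hP⟩ := hP
  obtain ⟨_, hQ⟩ := hQ
  have : Primrec fun a => Sum.casesOn (motive := fun _ => Bool) (f a) (fun b => decide (P a b))
      fun c => decide (Q a c) :=
    Primrec.sumCasesOn hf (hP.of_eq fun p => by congr) (hQ.of_eq fun p => by congr)
  refine ⟨Classical.decPred _, this.of_eq fun a => ?_⟩
  cases h : f a <;> simp [h]

theorem primrecPred_forall_mem {f : α → List β} {R : α → β → Prop} (hf : Primrec f)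
    (hR : PrimrecPred fun p : α × β => R p.1 p.2) : PrimrecPred fun a => ∀ b ∈ f a, R a b := by
  have h1 : PrimrecRel fun (b : β) (a : α) => R a b := hR.comp (Primrec.pair Primrec.snd Primrec.fst)
  exact h1.forall_mem_list.comp hf Primrec.id

theorem primrecPred_exists_mem {f : α → List β} {R : α → β → Prop} (hf : Primrec f)
    (hR : PrimrecPred fun p : α × β => R p.1 p.2) : PrimrecPred fun a => ∃ b ∈ f a, R a b := by
  have h1 : PrimrecRel fun (b : β) (a : α) => R a b := hR.comp (Primrec.pair Primrec.snd Primrec.fst)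
  exact h1.exists_mem_list.comp hf Primrec.id

theorem primrecPred_atom_wf : PrimrecPred fun p : ℕ × Atom binarySignature => p.2.WF p.1 := by
  refine (primrecPred_sumElim (f := fun p : ℕ × Atom binarySignature => p.2)
    (P := fun p q => q.1 < p.1 ∧ q.2 < p.1)
    (Q := fun p q => q.2.length = 2 ∧ ∀ i ∈ q.2, i < p.1) Primrec.snd ?_ ?_).of_eq ?_
  · exact (Primrec.nat_lt.comp (Primrec.fst.comp Primrec.snd) (Primrec.fst.comp Primrec.fst)).and
      (Primrec.nat_lt.comp (Primrec.snd.comp Primrec.snd) (Primrec.fst.comp Primrec.fst))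
  · exact (Primrec.eq.comp (Primrec.list_length.comp (Primrec.snd.comp Primrec.snd))
      (Primrec.const 2)).and (primrecPred_forall_mem (Primrec.snd.comp Primrec.snd)
        (Primrec.nat_lt.comp Primrec.snd (Primrec.fst.comp (Primrec.fst.comp Primrec.fst))))
  · rintro ⟨k, (⟨i, j⟩ | ⟨s, v⟩)⟩ <;> rfl

theorem primrecPred_qfree_wf : PrimrecPred fun p : ℕ × QFree binarySignature => p.2.WF p.1 :=
  primrecPred_forall_mem Primrec.snd (primrecPred_forall_mem Primrec.snd
    (primrecPred_atom_wf.comp (Primrec.pair (Primrec.fst.comp (Primrec.fst.comp Primrec.fst))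
      (Primrec.snd.comp Primrec.snd))))

theorem natOrder_rel_iff {s : Unit} {v : List ℕ} :
    natOrder.Rel s v ↔ v.length = 2 ∧ v.getD 0 0 < v.getD 1 0 := by
  constructor
  · rintro ⟨a, b, rfl, h⟩
    exact ⟨rfl, h⟩
  · rintro ⟨h, h'⟩
    obtain ⟨a, b, rfl⟩ := List.length_eq_two.1 h
    exact ⟨a, b, rfl, h'⟩

theorem primrecPred_natOrder_rel {f : α → List ℕ} (hf : Primrec f) :
    PrimrecPred fun a => natOrder.Rel () (f a) := by
  have hg : ∀ i, Primrec fun a => (f a).getD i 0 := fun i =>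
    (Primrec.list_getD 0).comp hf (Primrec.const i)
  exact ((Primrec.eq.comp (Primrec.list_length.comp hf) (Primrec.const 2)).and
    (Primrec.nat_lt.comp (hg 0) (hg 1))).of_eq fun a => natOrder_rel_iff.symm

theorem primrecPred_atom_holds :
    PrimrecPred fun p : List ℕ × Atom binarySignature => p.2.Holds natOrder p.1 := by
  have hg : Primrec fun q : List ℕ × ℕ => q.1.getD q.2 0 := Primrec.list_getD 0
  refine (primrecPred_sumElim (f := fun p : List ℕ × Atom binarySignature => p.2)
    (P := fun p q => p.1.getD q.1 0 = p.1.getD q.2 0)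
    (Q := fun p q => natOrder.Rel () (q.2.map fun i => p.1.getD i 0)) Primrec.snd ?_ ?_).of_eq ?_
  · exact Primrec.eq.comp
      (hg.comp (Primrec.pair (Primrec.fst.comp Primrec.fst) (Primrec.fst.comp Primrec.snd)))
      (hg.comp (Primrec.pair (Primrec.fst.comp Primrec.fst) (Primrec.snd.comp Primrec.snd)))
  · exact primrecPred_natOrder_rel (Primrec.list_map (Primrec.snd.comp Primrec.snd)
      (hg.comp (Primrec.pair (Primrec.fst.comp (Primrec.fst.comp Primrec.fst)) Primrec.snd)).to₂)
  · rintro ⟨k, (⟨i, j⟩ | ⟨s, v⟩)⟩ <;> rfl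

theorem primrecPred_literal_holds :
    PrimrecPred fun p : List ℕ × Literal binarySignature => p.2.Holds natOrder p.1 := by
  have h1 : PrimrecPred fun p : List ℕ × Literal binarySignature => p.2.2.Holds natOrder p.1 :=
    primrecPred_atom_holds.comp (Primrec.pair Primrec.fst (Primrec.snd.comp Primrec.snd))
  have h2 : PrimrecPred fun p : List ℕ × Literal binarySignature => p.2.1 = true :=
    Primrec.eq.comp (Primrec.fst.comp Primrec.snd) (Primrec.const true)
  refine ((h2.and h1).or (h2.not.and h1.not)).of_eq ?_
  rintro ⟨a, b, l⟩
  cases b <;> simp [Literal.Holds]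

theorem primrecPred_qfree_holds :
    PrimrecPred fun p : List ℕ × QFree binarySignature => p.2.Holds natOrder p.1 :=
  primrecPred_exists_mem Primrec.snd (primrecPred_forall_mem Primrec.snd
    (primrecPred_literal_holds.comp (Primrec.pair
      (Primrec.fst.comp (Primrec.fst.comp Primrec.fst)) Primrec.snd)))

theorem primrecPred_path :
    PrimrecPred fun p : List Bool × List ℕ × ℕ => Path id NatStep 0 p.1 p.2.1 p.2.2 := by
  have hl : Primrec fun p : List Bool × List ℕ × ℕ => p.2.1 ++ [p.2.2] :=
    Primrec.list_concat.comp (Primrec.fst.comp Primrec.snd) (Primrec.snd.comp Primrec.snd)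
  have hb : Primrec fun p : (List Bool × List ℕ × ℕ) × ℕ => (p.1.2.1 ++ [p.1.2.2]).getD p.2 0 :=
    (Primrec.list_getD 0).comp (hl.comp Primrec.fst) Primrec.snd
  have ha : Primrec fun p : (List Bool × List ℕ × ℕ) × ℕ =>
      (0 :: (p.1.2.1 ++ [p.1.2.2])).getD p.2 0 :=
    (Primrec.list_getD 0).comp (Primrec.list_cons.comp (Primrec.const 0) (hl.comp Primrec.fst))
      Primrec.snd
  have hg : Primrec fun p : (List Bool × List ℕ × ℕ) × ℕ => p.1.1.getD p.2 true :=
    (Primrec.list_getD true).comp (Primrec.fst.comp Primrec.fst) Primrec.snd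
  refine ((Primrec.eq.comp (Primrec.list_length.comp Primrec.fst) (Primrec.succ.comp
    (Primrec.list_length.comp (Primrec.fst.comp Primrec.snd)))).and
    (primrecPred_forall_lt ?_ (Primrec.list_length.comp Primrec.fst))).of_eq
      fun p => (path_natStep_iff (m := 0)).symm
  refine (Primrec.nat_lt.comp ha hb).and (((Primrec.eq.comp hg (Primrec.const false)).not.or
    (Primrec.eq.comp hb (Primrec.succ.comp ha))).of_eq fun p => ?_)
  rw [imp_iff_not_or]

theorem sigOne_inCE : SigOne fun p : Nat.Partrec.Code × α => InCE p.1 p.2 :=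
  SigOne.dom (Nat.Partrec.Code.eval_part.comp Computable.fst
    (Computable.encode.comp Computable.snd))

/-- Only the enumeration of disjuncts and the search for positions are unbounded: quantifier-free
truth in `(ℕ, <)` is decidable. -/
theorem sigOne_wordHolds : SigOne fun p : List Bool × ℕ × Nat.Partrec.Code × List ℕ =>
    WordHolds p.1 p.2.1 p.2.2.1 p.2.2.2 := by
  let A := List Bool × ℕ × Nat.Partrec.Code × List ℕ
  let E := Existential binarySignature × ℕ × List ℕ × List ℕ
  have hw : Primrec fun p : A × E => p.1.1 := Primrec.fst.comp Primrec.fst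
  have hn : Primrec fun p : A × E => p.1.2.1 :=
    Primrec.fst.comp (Primrec.snd.comp Primrec.fst)
  have he : Primrec fun p : A × E => p.1.2.2.1 :=
    Primrec.fst.comp (Primrec.snd.comp (Primrec.snd.comp Primrec.fst))
  have ht : Primrec fun p : A × E => p.1.2.2.2 :=
    Primrec.snd.comp (Primrec.snd.comp (Primrec.snd.comp Primrec.fst))
  have hφ : Primrec fun p : A × E => p.2.1 := Primrec.fst.comp Primrec.snd
  have hφ1 : Primrec fun p : A × E => p.2.1.1 := Primrec.fst.comp hφ
  have hφ2 : Primrec fun p : A × E => p.2.1.2 := Primrec.snd.comp hφ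
  have hT : Primrec fun p : A × E => p.2.2.1 := Primrec.fst.comp (Primrec.snd.comp Primrec.snd)
  have hp : Primrec fun p : A × E => p.2.2.2.1 :=
    Primrec.fst.comp (Primrec.snd.comp (Primrec.snd.comp Primrec.snd))
  have hb : Primrec fun p : A × E => p.2.2.2.2 :=
    Primrec.snd.comp (Primrec.snd.comp (Primrec.snd.comp Primrec.snd))
  have h1 : SigOne fun p : A × E => InCE p.1.2.2.1 p.2.1 :=
    sigOne_inCE.comp_primrec (Primrec.pair he hφ)
  have h2 : PrimrecPred fun p : A × E => QFree.WF (p.1.2.1 + p.2.1.1) p.2.1.2 :=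
    primrecPred_qfree_wf.comp (Primrec.pair (Primrec.nat_add.comp hn hφ1) hφ2)
  have h3 : PrimrecPred fun p : A × E => Path id NatStep 0 p.1.1 p.2.2.2.1 p.2.2.1 :=
    primrecPred_path.comp (Primrec.pair hw (Primrec.pair hp hT))
  have h4 : PrimrecPred fun p : A × E => p.2.2.2.2.length = p.2.1.1 :=
    Primrec.eq.comp (Primrec.list_length.comp hb) hφ1
  have h5 : PrimrecPred fun p : A × E => ∀ z ∈ p.2.2.2.2, 0 < z ∧ z < p.2.2.1 :=
    primrecPred_forall_mem hb ((Primrec.nat_lt.comp (Primrec.const 0) Primrec.snd).and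
      (Primrec.nat_lt.comp Primrec.snd (hT.comp Primrec.fst)))
  have h6 : PrimrecPred fun p : A × E => QFree.Holds natOrder
      (p.1.2.2.2.map (fun i => p.2.2.2.1.getD i 0) ++ p.2.2.2.2) p.2.1.2 :=
    primrecPred_qfree_holds.comp (Primrec.pair (Primrec.list_append.comp (Primrec.list_map ht
      ((Primrec.list_getD 0).comp (hp.comp Primrec.fst) Primrec.snd).to₂) hb) hφ2)
  have h7 : PrimrecPred fun p : A × E => p.1.2.2.2.length = p.1.2.1 :=
    Primrec.eq.comp (Primrec.list_length.comp ht) hn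
  have := (((SigOne.of_primrec h7).and h1).and
    (SigOne.of_primrec ((h2.and h3).and ((h4.and h5).and h6)))).ex
  refine this.of_iff fun p => ?_
  constructor
  · rintro ⟨a, φ, T, pos, b, a1, a2, a3, a4, a5, a6⟩
    exact ⟨(φ, T, pos, b), ⟨a, a1⟩, ⟨a2, a3⟩, ⟨a4, a5⟩, a6⟩
  · rintro ⟨⟨φ, T, pos, b⟩, ⟨a, a1⟩, ⟨a2, a3⟩, ⟨a4, a5⟩, a6⟩
    exact ⟨a, φ, T, pos, b, a1, a2, a3, a4, a5, a6⟩

end Computability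

/-! ### Oracle computations from finitely many oracle values -/

section Oracle

/-- The computation of a program with a partial function as oracle. -/
def OracleCode.evalWith (g : ℕ →. ℕ) : OracleCode → ℕ →. ℕ
  | .zero => fun _ => Part.some 0
  | .succ => fun n => Part.some (n + 1)
  | .left => fun n => Part.some (Nat.unpair n).1
  | .right => fun n => Part.some (Nat.unpair n).2
  | .oracle => fun n => g n
  | .pair c d => fun n => Nat.pair <$> c.evalWith g n <*> d.evalWith g n
  | .comp c d => fun n => d.evalWith g n >>= c.evalWith g
  | .prec c d => fun q =>
      (Nat.unpair q).2.rec (c.evalWith g (Nat.unpair q).1) fun y IH => do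
        let i ← IH
        d.evalWith g (Nat.pair (Nat.unpair q).1 (Nat.pair y i))
  | .rfind c => fun a =>
      Nat.rfind fun n => (fun m => decide (m = 0)) <$> c.evalWith g (Nat.pair a n)

theorem eval_eq_evalWith (g : ℕ → ℕ) (c : OracleCode) :
    c.eval g = c.evalWith fun n => Part.some (g n) := by
  induction c with
  | zero | succ | left | right | oracle => rfl
  | pair c d hc hd =>
    exact congrArg₂ (fun (f h : ℕ →. ℕ) => ((fun n => Nat.pair <$> f n <*> h n) : ℕ →. ℕ)) hc hd
  | comp c d hc hd =>
    exact congrArg₂ (fun (f h : ℕ →. ℕ) => ((fun n => h n >>= f) : ℕ →. ℕ)) hc hd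
  | prec c d hc hd =>
    exact congrArg₂ (fun (f h : ℕ →. ℕ) => ((fun q =>
      (Nat.unpair q).2.rec (f (Nat.unpair q).1) fun y IH =>
        IH >>= fun i => h (Nat.pair (Nat.unpair q).1 (Nat.pair y i))) : ℕ →. ℕ)) hc hd
  | rfind c hc =>
    exact congrArg (fun (f : ℕ →. ℕ) => ((fun a =>
      Nat.rfind fun n => (fun m => decide (m = 0)) <$> f (Nat.pair a n)) : ℕ →. ℕ)) hc

section MemEvalWith

variable {g : ℕ →. ℕ} {c d : OracleCode} {n m a k : ℕ}

theorem mem_evalWith_pair : m ∈ (c.pair d).evalWith g n ↔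
    ∃ x ∈ c.evalWith g n, ∃ y ∈ d.evalWith g n, Nat.pair x y = m := by
  refine Part.mem_bind_iff.trans ?_
  constructor
  · rintro ⟨f, hf, hm⟩
    obtain ⟨x, hx, rfl⟩ := (Part.mem_map_iff _).1 hf
    obtain ⟨y, hy, e⟩ := (Part.mem_map_iff _).1 hm
    exact ⟨x, hx, y, hy, e⟩
  · rintro ⟨x, hx, y, hy, e⟩
    exact ⟨_, (Part.mem_map_iff _).2 ⟨x, hx, rfl⟩, (Part.mem_map_iff _).2 ⟨y, hy, e⟩⟩

theorem mem_evalWith_comp : m ∈ (c.comp d).evalWith g n ↔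
    ∃ x ∈ d.evalWith g n, m ∈ c.evalWith g x := Part.mem_bind_iff

theorem evalWith_prec_pair : (c.prec d).evalWith g (Nat.pair a k) =
    (k.rec (c.evalWith g a) fun y IH =>
      IH.bind fun i => d.evalWith g (Nat.pair a (Nat.pair y i)) : Part ℕ) := by
  let R : ℕ × ℕ → Part ℕ := fun u => u.2.rec (c.evalWith g u.1) fun y IH =>
    IH.bind fun i => d.evalWith g (Nat.pair u.1 (Nat.pair y i))
  have h : ∀ q, (c.prec d).evalWith g q = R (Nat.unpair q) := fun q => rfl
  rw [h, Nat.unpair_pair]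

theorem mem_evalWith_prec_zero : m ∈ (c.prec d).evalWith g (Nat.pair a 0) ↔
    m ∈ c.evalWith g a := by
  rw [evalWith_prec_pair]
  exact Iff.rfl

theorem mem_evalWith_prec_succ : m ∈ (c.prec d).evalWith g (Nat.pair a (k + 1)) ↔
    ∃ x ∈ (c.prec d).evalWith g (Nat.pair a k), m ∈ d.evalWith g (Nat.pair a (Nat.pair k x)) := by
  rw [evalWith_prec_pair, evalWith_prec_pair]
  exact Part.mem_bind_iff

theorem mem_evalWith_rfind : m ∈ c.rfind.evalWith g n ↔
    (∃ x ∈ c.evalWith g (Nat.pair n m), x = 0) ∧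
      ∀ k < m, ∃ x ∈ c.evalWith g (Nat.pair n k), x ≠ 0 := by
  refine Nat.mem_rfind.trans (and_congr ?_ (forall₂_congr fun k _ => ?_)) <;>
  exact (Part.mem_map_iff _).trans (by simp)

end MemEvalWith

theorem evalWith_mono {g h : ℕ →. ℕ} (H : ∀ n, ∀ m ∈ g n, m ∈ h n) (c : OracleCode) {n m : ℕ}
    (hm : m ∈ c.evalWith g n) : m ∈ c.evalWith h n := by
  induction c generalizing n m with
  | zero | succ | left | right => exact hm
  | oracle => exact H n m hm
  | pair c d hc hd =>
    obtain ⟨x, hx, y, hy, e⟩ := mem_evalWith_pair.1 hm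
    exact mem_evalWith_pair.2 ⟨x, hc hx, y, hd hy, e⟩
  | comp c d hc hd =>
    obtain ⟨x, hx, hm⟩ := mem_evalWith_comp.1 hm
    exact mem_evalWith_comp.2 ⟨x, hd hx, hc hm⟩
  | prec c d hc hd =>
    obtain ⟨a, k, rfl⟩ : ∃ a k, Nat.pair a k = n := ⟨_, _, Nat.pair_unpair n⟩
    induction k generalizing m with
    | zero => exact mem_evalWith_prec_zero.2 (hc (mem_evalWith_prec_zero.1 hm))
    | succ k ih =>
      obtain ⟨x, hx, hm⟩ := mem_evalWith_prec_succ.1 hm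
      exact mem_evalWith_prec_succ.2 ⟨x, ih hx, hd hm⟩
  | rfind c hc =>
    obtain ⟨⟨x, hx, e⟩, h'⟩ := mem_evalWith_rfind.1 hm
    refine mem_evalWith_rfind.2 ⟨⟨x, hc hx, e⟩, fun k hk => ?_⟩
    obtain ⟨y, hy, e⟩ := h' k hk
    exact ⟨y, hc hy, e⟩

/-- The computation of a program from a finite initial segment of the oracle. -/
def OracleCode.evalSegment (p : List ℕ) (c : OracleCode) : ℕ →. ℕ :=
  c.evalWith fun n => (p[n]? : Option ℕ)

/-- A finite oracle is part of the input, and a query beyond it diverges; the evaluation is thus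
partial recursive without any oracle. -/
theorem partrec_evalSegment (c : OracleCode) :
    Partrec fun q : List ℕ × ℕ => c.evalSegment q.1 q.2 := by
  have hpair : Computable₂ Nat.pair := Primrec₂.natPair.to_comp
  induction c with
  | zero => exact (Computable.const 0).partrec
  | succ => exact (Computable.succ.comp Computable.snd).partrec
  | left => exact (Computable.fst.comp (Computable.unpair.comp Computable.snd)).partrec
  | right => exact (Computable.snd.comp (Computable.unpair.comp Computable.snd)).partrec
  | oracle => exact (Computable.list_getElem?.comp Computable.fst Computable.snd).ofOption
  | pair c d hc hd =>
    refine (Partrec.bind hc (Partrec.map (hd.comp Computable.fst)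
      (g := fun q (y : ℕ) => Nat.pair q.2 y) ?_).to₂).of_eq fun q => ?_
    · exact hpair.comp (Computable.snd.comp Computable.fst) Computable.snd
    · simp only [OracleCode.evalSegment, OracleCode.evalWith, Seq.seq, Part.map_eq_map,
        Part.bind_map]
  | comp c d hc hd =>
    exact Partrec.bind hd (hc.comp
      (Computable.pair (Computable.fst.comp Computable.fst) Computable.snd)).to₂
  | prec c d hc hd =>
    have hu : Computable fun q : List ℕ × ℕ => (Nat.unpair q.2) :=
      Computable.unpair.comp Computable.snd
    have h1 : Computable fun q : (List ℕ × ℕ) × ℕ × ℕ =>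
        (q.1.1, Nat.pair (Nat.unpair q.1.2).1 (Nat.pair q.2.1 q.2.2)) :=
      Computable.pair (Computable.fst.comp Computable.fst) (hpair.comp
        (Computable.fst.comp (hu.comp Computable.fst))
        (hpair.comp (Computable.fst.comp Computable.snd) (Computable.snd.comp Computable.snd)))
    have h2 : Computable fun q : List ℕ × ℕ => (q.1, (Nat.unpair q.2).1) :=
      Computable.pair Computable.fst (Computable.fst.comp hu)
    exact Partrec.nat_rec (Computable.snd.comp hu) (hc.comp h2) (hd.comp h1).to₂
  | rfind c hc =>
    have h1 : Computable fun q : (List ℕ × ℕ) × ℕ => (q.1.1, Nat.pair q.1.2 q.2) :=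
      Computable.pair (Computable.fst.comp Computable.fst)
        (hpair.comp (Computable.snd.comp Computable.fst) Computable.snd)
    have h2 : Primrec₂ fun (_ : (List ℕ × ℕ) × ℕ) (m : ℕ) => decide (m = 0) :=
      (Primrec.eq.comp Primrec.snd (Primrec.const 0)).decide
    exact Partrec.rfind (Partrec.map (hc.comp h1) h2.to_comp).to₂

/-- An initial segment of a function. -/
def segment (g : ℕ → ℕ) (M : ℕ) : List ℕ := (List.range M).map g

theorem mem_segment_iff {g : ℕ → ℕ} {M n m : ℕ} :
    m ∈ ((segment g M)[n]? : Option ℕ) ↔ n < M ∧ g n = m := by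
  simp [segment, List.getElem?_map, Option.map_eq_some_iff,
    List.getElem?_eq_some_iff]

theorem evalSegment_mono {g : ℕ → ℕ} {M M' : ℕ} (h : M ≤ M') (c : OracleCode) {n m : ℕ}
    (hm : m ∈ c.evalSegment (segment g M) n) : m ∈ c.evalSegment (segment g M') n := by
  refine evalWith_mono (fun n m h' => ?_) c hm
  rw [Part.mem_ofOption, mem_segment_iff] at h' ⊢
  exact ⟨h'.1.trans_le h, h'.2⟩

theorem evalSegment_sound {g : ℕ → ℕ} {M : ℕ} (c : OracleCode) {n m : ℕ}
    (hm : m ∈ c.evalSegment (segment g M) n) : m ∈ c.eval g n := by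
  rw [eval_eq_evalWith]
  refine evalWith_mono (fun n m h' => ?_) c hm
  rw [Part.mem_ofOption, mem_segment_iff] at h'
  exact Part.mem_some_iff.2 h'.2.symm

theorem exists_forall_lt_of_mono {P : ℕ → ℕ → Prop} {n : ℕ}
    (hP : ∀ i M M', M ≤ M' → P i M → P i M') (h : ∀ i < n, ∃ M, P i M) :
    ∃ M, ∀ i < n, P i M := by
  induction n with
  | zero => exact ⟨0, by simp⟩
  | succ n ih =>
    obtain ⟨M, hM⟩ := ih fun i hi => h i (hi.trans n.lt_succ_self)
    obtain ⟨M', hM'⟩ := h n n.lt_succ_self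
    refine ⟨max M M', fun i hi => ?_⟩
    rcases Nat.lt_succ_iff_lt_or_eq.1 hi with hi | rfl
    · exact hP i _ _ (le_max_left _ _) (hM i hi)
    · exact hP i _ _ (le_max_right _ _) hM'

/-- The use principle: a halting computation asks finitely many questions. Subcomputations are
brought to a common segment by monotonicity. -/
theorem exists_evalSegment {g : ℕ → ℕ} (c : OracleCode) {n m : ℕ}
    (hm : m ∈ c.eval g n) : ∃ M, m ∈ c.evalSegment (segment g M) n := by
  rw [eval_eq_evalWith] at hm
  induction c generalizing n m with
  | zero | succ | left | right => exact ⟨0, hm⟩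
  | oracle =>
    refine ⟨n + 1, Part.mem_ofOption.2 (mem_segment_iff.2 ⟨n.lt_succ_self, ?_⟩)⟩
    exact (Part.mem_some_iff.1 hm).symm
  | pair c d hc hd =>
    obtain ⟨x, hx, y, hy, e⟩ := mem_evalWith_pair.1 hm
    obtain ⟨M, hM⟩ := hc hx
    obtain ⟨M', hM'⟩ := hd hy
    exact ⟨max M M', mem_evalWith_pair.2 ⟨x, evalSegment_mono (le_max_left _ _) c hM, y,
      evalSegment_mono (le_max_right _ _) d hM', e⟩⟩
  | comp c d hc hd =>
    obtain ⟨x, hx, hm⟩ := mem_evalWith_comp.1 hm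
    obtain ⟨M, hM⟩ := hd hx
    obtain ⟨M', hM'⟩ := hc hm
    exact ⟨max M M', mem_evalWith_comp.2 ⟨x, evalSegment_mono (le_max_left _ _) d hM,
      evalSegment_mono (le_max_right _ _) c hM'⟩⟩
  | prec c d hc hd =>
    obtain ⟨a, k, rfl⟩ : ∃ a k, Nat.pair a k = n := ⟨_, _, Nat.pair_unpair n⟩
    induction k generalizing m with
    | zero =>
      obtain ⟨M, hM⟩ := hc (mem_evalWith_prec_zero.1 hm)
      exact ⟨M, mem_evalWith_prec_zero.2 hM⟩
    | succ k ih =>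
      obtain ⟨x, hx, hm⟩ := mem_evalWith_prec_succ.1 hm
      obtain ⟨M, hM⟩ := ih hx
      obtain ⟨M', hM'⟩ := hd hm
      exact ⟨max M M', mem_evalWith_prec_succ.2
        ⟨x, evalSegment_mono (le_max_left _ _) (c.prec d) hM,
          evalSegment_mono (le_max_right _ _) d hM'⟩⟩
  | rfind c hc =>
    obtain ⟨⟨x, hx, e⟩, h'⟩ := mem_evalWith_rfind.1 hm
    obtain ⟨M, hM⟩ := hc hx
    obtain ⟨M', hM'⟩ := exists_forall_lt_of_mono (n := m)
      (P := fun k M => ∃ y ∈ c.evalSegment (segment g M) (Nat.pair n k), y ≠ 0)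
      (fun k M M' hM ⟨y, hy, e⟩ => ⟨y, evalSegment_mono hM c hy, e⟩) fun k hk => by
        obtain ⟨y, hy, e⟩ := h' k hk
        obtain ⟨M, hM⟩ := hc hy
        exact ⟨M, y, hM, e⟩
    refine ⟨max M M', mem_evalWith_rfind.2
      ⟨⟨x, evalSegment_mono (le_max_left _ _) c hM, e⟩, fun k hk => ?_⟩⟩
    obtain ⟨y, hy, e⟩ := hM' k hk
    exact ⟨y, evalSegment_mono (le_max_right _ _) c hy, e⟩

end Oracle

/-! ### Cycles -/

section Cycles

/-- The structure has a cycle of length `k`, for its binary relation. -/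
def HasCycle (A : Struc binarySignature) (k : ℕ) : Prop :=
  ∃ v : ℕ → ℕ, (∀ i < k, ∀ j < i, v j ≠ v i) ∧ ∀ i < k, A.Rel () [v i, v ((i + 1) % k)]

theorem IsCopy.hasCycle {A B : Struc binarySignature} (h : IsCopy A B) {k : ℕ} :
    HasCycle A k ↔ HasCycle B k := by
  obtain ⟨f, hf⟩ := h
  constructor
  · rintro ⟨v, hv, hv'⟩
    exact ⟨f ∘ v, fun i hi j hj e => hv i hi j hj (f.injective e),
      fun i hi => (hf () [_, _]).1 (hv' i hi)⟩
  · rintro ⟨v, hv, hv'⟩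
    refine ⟨f.symm ∘ v, fun i hi j hj e => hv i hi j hj (f.symm.injective e),
      fun i hi => (hf () [_, _]).2 ?_⟩
    simpa using hv' i hi

/-- The code of an atomic formula in the diagram. -/
def edgeCode (x y : ℕ) : ℕ := Encodable.encode ((() : binarySignature.Sym), [x, y])

theorem primrec_edgeCode : Primrec₂ edgeCode :=
  Primrec.encode.comp (Primrec.pair (Primrec.const (() : Unit)) (Primrec.list_cons.comp Primrec.fst
    (Primrec.list_cons.comp Primrec.snd (Primrec.const ([] : List ℕ)))))

theorem chi_eq_one {X : Set ℕ} {n : ℕ} : chi X n = 1 ↔ n ∈ X := by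
  classical
  simp [chi, Set.indicator_apply]

theorem chi_eq_zero {X : Set ℕ} {n : ℕ} : chi X n = 0 ↔ n ∉ X := by
  classical
  simp [chi, Set.indicator_apply]

theorem chi_edgeCode {A : Struc binarySignature} {x y : ℕ} :
    chi (diagram A) (edgeCode x y) = 1 ↔ A.Rel () [x, y] := by
  rw [chi_eq_one]
  constructor
  · rintro ⟨s, v, e, h⟩
    obtain ⟨-, rfl⟩ := Prod.mk.inj (Encodable.encode_injective e)
    exact h
  · exact fun h => ⟨(), [x, y], rfl, h⟩

/-- The computation of `c` from the segment `p` of the oracle yields a cycle of length `k`. -/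
def SegmentCycle (c : OracleCode) (p : List ℕ) (k : ℕ) : Prop :=
  ∃ v : List ℕ, (∀ i < k, ∀ j < i, v.getD j 0 ≠ v.getD i 0) ∧
    ∀ i < k, 1 ∈ c.evalSegment p (edgeCode (v.getD i 0) (v.getD ((i + 1) % k) 0))

theorem sigOne_segmentCycle (c : OracleCode) :
    SigOne fun q : List ℕ × ℕ => SegmentCycle c q.1 q.2 := by
  have hk : Primrec fun q : (List ℕ × ℕ) × List ℕ => q.1.2 := Primrec.snd.comp Primrec.fst
  have h1 : PrimrecPred fun q : (List ℕ × ℕ) × List ℕ =>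
      ∀ i < q.1.2, ∀ j < i, q.2.getD j 0 ≠ q.2.getD i 0 := by
    refine primrecPred_forall_lt (R := fun (q : (List ℕ × ℕ) × List ℕ) i =>
        ∀ j < i, q.2.getD j 0 ≠ q.2.getD i 0)
      (primrecPred_forall_lt (R := fun (q : ((List ℕ × ℕ) × List ℕ) × ℕ) j =>
        q.1.2.getD j 0 ≠ q.1.2.getD q.2 0) (Primrec.eq.comp ?_ ?_).not Primrec.snd) hk
    · exact (Primrec.list_getD 0).comp (Primrec.snd.comp (Primrec.fst.comp Primrec.fst)) Primrec.snd
    · exact (Primrec.list_getD 0).comp (Primrec.snd.comp (Primrec.fst.comp Primrec.fst))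
        (Primrec.snd.comp Primrec.fst)
  have h2 : SigOne fun q : (List ℕ × ℕ) × List ℕ => ∀ i < q.1.2,
      1 ∈ c.evalSegment q.1.1 (edgeCode (q.2.getD i 0) (q.2.getD ((i + 1) % q.1.2) 0)) := by
    have hi : Primrec fun r : ((List ℕ × ℕ) × List ℕ) × ℕ => r.1.2.getD r.2 0 :=
      (Primrec.list_getD 0).comp (Primrec.snd.comp Primrec.fst) Primrec.snd
    have hj : Primrec fun r : ((List ℕ × ℕ) × List ℕ) × ℕ =>
        r.1.2.getD ((r.2 + 1) % r.1.1.2) 0 :=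
      (Primrec.list_getD 0).comp (Primrec.snd.comp Primrec.fst)
        (Primrec.nat_mod.comp (Primrec.succ.comp Primrec.snd) (hk.comp Primrec.fst))
    exact SigOne.ball (P := fun (q : (List ℕ × ℕ) × List ℕ) i =>
      1 ∈ c.evalSegment q.1.1 (edgeCode (q.2.getD i 0) (q.2.getD ((i + 1) % q.1.2) 0)))
      ((SigOne.graph (partrec_evalSegment c)).comp_primrec (Primrec.pair (Primrec.pair
        (Primrec.fst.comp (Primrec.fst.comp Primrec.fst)) (primrec_edgeCode.comp hi hj))
        (Primrec.const 1))) hk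
  exact ((SigOne.of_primrec h1).and h2).ex

/-- A cycle consists of finitely many edges, so a single segment of the oracle suffices to output
them all. -/
theorem hasCycle_iff_segmentCycle {c : OracleCode} {g : ℕ → ℕ} {A : Struc binarySignature}
    (h : ∀ n, c.eval g n = Part.some (chi (diagram A) n)) {k : ℕ} :
    HasCycle A k ↔ ∃ M, SegmentCycle c (segment g M) k := by
  constructor
  · rintro ⟨v, hv, hv'⟩
    obtain ⟨M, hM⟩ := exists_forall_lt_of_mono (n := k)
      (P := fun i M => 1 ∈ c.evalSegment (segment g M) (edgeCode (v i) (v ((i + 1) % k))))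
      (fun i M M' hM hi => evalSegment_mono hM c hi) fun i hi =>
        exists_evalSegment c (by rw [h, Part.mem_some_iff, eq_comm, chi_edgeCode]; exact hv' i hi)
    have hg : ∀ i < k, ((List.range k).map v).getD i 0 = v i := fun i hi => by
      simp [List.getD, hi]
    refine ⟨M, (List.range k).map v, fun i hi j hj => ?_, fun i hi => ?_⟩
    · rw [hg i hi, hg j (hj.trans hi)]
      exact hv i hi j hj
    · rw [hg i hi, hg _ (Nat.mod_lt _ (by omega))]
      exact hM i hi
  · rintro ⟨M, v, hv, hv'⟩
    refine ⟨fun i => v.getD i 0, hv, fun i hi => ?_⟩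
    have := evalSegment_sound c (hv' i hi)
    rwa [h, Part.mem_some_iff, eq_comm, chi_edgeCode] at this

end Cycles

/-! ### Relative computability from segments -/

section Relative

variable {O : Set (ℕ →. ℕ)}

theorem natRecursiveIn_comp {f h : ℕ → ℕ} (hf : Nat.RecursiveIn O fun n => Part.some (f n))
    (hh : Nat.RecursiveIn O fun n => Part.some (h n)) :
    Nat.RecursiveIn O fun n => Part.some (f (h n)) :=
  (Nat.RecursiveIn.comp hf hh).of_eq fun _ => Part.bind_some _ _

theorem natRecursiveIn_pair {f h : ℕ → ℕ} (hf : Nat.RecursiveIn O fun n => Part.some (f n))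
    (hh : Nat.RecursiveIn O fun n => Part.some (h n)) :
    Nat.RecursiveIn O fun n => Part.some (Nat.pair (f n) (h n)) :=
  (Nat.RecursiveIn.pair hf hh).of_eq fun _ => by simp [Seq.seq]

theorem natRecursiveIn_of_primrec {f : ℕ → ℕ} (hf : Primrec f) :
    Nat.RecursiveIn O fun n => Part.some (f n) :=
  (Primrec.nat_iff.1 hf).recursiveIn

theorem natRecursiveIn_segment (g : ℕ → ℕ) :
    Nat.RecursiveIn {fun n => Part.some (g n)}
      fun M => Part.some (Encodable.encode (segment g M)) := by
  let O : Set (ℕ →. ℕ) := {fun n => Part.some (g n)}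
  have hg : Nat.RecursiveIn O fun n => Part.some (g n) := .oracle _ rfl
  let cat : ℕ → ℕ := fun n => Encodable.encode
    (((Encodable.decode (n.unpair.1) : Option (List ℕ)).getD []) ++ [n.unpair.2])
  have hcat : Primrec cat :=
    Primrec.encode.comp (Primrec.list_concat.comp
      (Primrec.option_getD.comp (Primrec.decode.comp (Primrec.fst.comp Primrec.unpair))
        (Primrec.const [])) (Primrec.snd.comp Primrec.unpair))
  have hl : Primrec fun n : ℕ => n.unpair.1 := Primrec.fst.comp Primrec.unpair
  have hr : Primrec fun n : ℕ => n.unpair.2 := Primrec.snd.comp Primrec.unpair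
  -- The input codes a dummy parameter, the stage and the segment so far; the oracle value at the
  -- stage is appended.
  let step : ℕ → ℕ := fun q => cat (Nat.pair q.unpair.2.unpair.2 (g q.unpair.2.unpair.1))
  have hstep : Nat.RecursiveIn O fun q => Part.some (step q) :=
    natRecursiveIn_comp (f := cat) (natRecursiveIn_of_primrec hcat)
      (natRecursiveIn_pair (natRecursiveIn_of_primrec (hr.comp hr))
        (natRecursiveIn_comp hg (natRecursiveIn_of_primrec (hl.comp hr))))
  have hbase : Nat.RecursiveIn O fun _ => Part.some (Encodable.encode ([] : List ℕ)) :=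
    natRecursiveIn_of_primrec (Primrec.const _)
  have hin : Nat.RecursiveIn O fun M => Part.some (Nat.pair 0 M) :=
    natRecursiveIn_of_primrec (Primrec₂.natPair.comp (Primrec.const 0) Primrec.id)
  refine ((hbase.prec hstep).comp hin).of_eq fun M => (Part.bind_some _ _).trans ?_
  let R : ℕ × ℕ → Part ℕ := fun u => u.2.rec (Part.some (Encodable.encode ([] : List ℕ)))
    fun y IH => IH.bind fun i => Part.some (step (Nat.pair u.1 (Nat.pair y i)))
  change R (Nat.unpair (Nat.pair 0 M)) = _
  rw [Nat.unpair_pair]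
  induction M with
  | zero => rfl
  | succ M ih =>
    change (R (0, M)).bind _ = _
    rw [ih, Part.bind_some]
    simp [step, cat, segment, List.range_succ]

/-- Post's theorem relative to `g`: search for a segment length and a witness, coded together by
`z`, for membership or for non-membership, and report which was found. -/
theorem turingReducible_of_segments {g : ℕ → ℕ} {S : Set ℕ} {P Q : List ℕ × ℕ → Prop}
    (hP : SigOne P) (hQ : SigOne Q) (hS : ∀ n, n ∈ S ↔ ∃ M, P (segment g M, n))
    (hS' : ∀ n, n ∉ S ↔ ∃ M, Q (segment g M, n)) :
    TuringReducible (fun n => Part.some (chi S n)) (fun n => Part.some (g n)) := by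
  classical
  obtain ⟨R, hR, eR⟩ := hP
  obtain ⟨R', hR', eR'⟩ := hQ
  let O : Set (ℕ →. ℕ) := {fun n => Part.some (g n)}
  let D : ℕ → (List ℕ × ℕ) × ℕ := fun x =>
    (((Encodable.decode x.unpair.2 : Option (List ℕ)).getD [], x.unpair.1.unpair.1),
      x.unpair.1.unpair.2.unpair.2)
  have hl : Primrec fun n : ℕ => n.unpair.1 := Primrec.fst.comp Primrec.unpair
  have hr : Primrec fun n : ℕ => n.unpair.2 := Primrec.snd.comp Primrec.unpair
  have hD : Primrec D := Primrec.pair (Primrec.pair (Primrec.option_getD.comp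
    (Primrec.decode.comp hr) (Primrec.const [])) (hl.comp hl)) (hr.comp (hr.comp hl))
  let V : ℕ → ℕ := fun x => Nat.pair x (Encodable.encode (segment g x.unpair.2.unpair.1))
  have hV : Nat.RecursiveIn O fun x => Part.some (V x) :=
    natRecursiveIn_pair (natRecursiveIn_of_primrec Primrec.id)
      (natRecursiveIn_comp (natRecursiveIn_segment g) (natRecursiveIn_of_primrec (hl.comp hr)))
  have hDV : ∀ n z, D (V (Nat.pair n z)) = ((segment g z.unpair.1, n), z.unpair.2) := by
    intro n z
    simp [D, V]
  let T : ℕ → ℕ := fun x => if R (D x) ∨ R' (D x) then 0 else 1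
  have hT : Primrec T :=
    Primrec.ite ((hR.comp hD).or (hR'.comp hD)) (Primrec.const 0) (Primrec.const 1)
  let U : ℕ → ℕ := fun x => if R (D x) then 1 else 0
  have hU : Primrec U := Primrec.ite (hR.comp hD) (Primrec.const 1) (Primrec.const 0)
  have hTV := natRecursiveIn_comp (natRecursiveIn_of_primrec hT) hV
  have hUV := natRecursiveIn_comp (natRecursiveIn_of_primrec hU) hV
  have h1 := hUV.comp ((natRecursiveIn_of_primrec Primrec.id).pair hTV.rfind)
  refine RecursiveIn.iff_nat.2 (h1.of_eq_tot fun n => Part.mem_bind_iff.2 ?_)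
  have hex : ∃ z : ℕ, R ((segment g z.unpair.1, n), z.unpair.2) ∨
      R' ((segment g z.unpair.1, n), z.unpair.2) := by
    by_cases hn : n ∈ S
    · obtain ⟨M, hM⟩ := (hS n).1 hn
      obtain ⟨y, hy⟩ := (eR _).1 hM
      exact ⟨Nat.pair M y, .inl (by simpa using hy)⟩
    · obtain ⟨M, hM⟩ := (hS' n).1 hn
      obtain ⟨y, hy⟩ := (eR' _).1 hM
      exact ⟨Nat.pair M y, .inr (by simpa using hy)⟩
  have hmem : Nat.find hex ∈ Nat.rfind fun z =>
      (fun m => decide (m = 0)) <$> Part.some (T (V (Nat.pair n z))) := by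
    refine Nat.mem_rfind.2 ⟨(Part.mem_map_iff _).2 ⟨_, Part.mem_some _, ?_⟩, fun {m} hm =>
      (Part.mem_map_iff _).2 ⟨_, Part.mem_some _, ?_⟩⟩
    · simp only [T, hDV, Nat.find_spec hex, if_true, decide_true]
    · simp only [T, hDV, Nat.find_min hex hm, if_false, one_ne_zero, decide_false]
  refine ⟨Nat.pair n (Nat.find hex), ?_, Part.mem_some_iff.2 ?_⟩
  · refine Part.mem_bind_iff.2 ⟨Nat.pair n, (Part.mem_map_iff _).2 ⟨n, Part.mem_some _, rfl⟩,
      (Part.mem_map_iff _).2 ⟨_, hmem, rfl⟩⟩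
  · simp only [U, hDV]
    split_ifs with h
    · exact chi_eq_one.2 ((hS n).2 ⟨_, (eR _).2 ⟨_, h⟩⟩)
    · exact chi_eq_zero.2 ((hS' n).2 ⟨_, (eR' _).2 ⟨_, (Nat.find_spec hex).resolve_left h⟩⟩)

/-- A set such that membership and non-membership of `n` are expressed by the existence of cycles
of certain lengths is computable from the structure. -/
theorem computes_of_hasCycle {A : Struc binarySignature} {S : Set ℕ} {f f' : ℕ → ℕ}
    (hf : Primrec f) (hf' : Primrec f') (hS : ∀ n, n ∈ S ↔ HasCycle A (f n))
    (hS' : ∀ n, n ∉ S ↔ HasCycle A (f' n)) : Computes A S := by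
  have h : ∀ n, OracleCode.oracle.eval (chi (diagram A)) n = Part.some (chi (diagram A) n) :=
    fun n => rfl
  exact turingReducible_of_segments
    ((sigOne_segmentCycle .oracle).comp_primrec (Primrec.pair Primrec.fst (hf.comp Primrec.snd)))
    ((sigOne_segmentCycle .oracle).comp_primrec (Primrec.pair Primrec.fst (hf'.comp Primrec.snd)))
    (fun n => (hS n).trans (hasCycle_iff_segmentCycle h))
    (fun n => (hS' n).trans (hasCycle_iff_segmentCycle h))

end Relative

/-! ### Copies of the jump of a linear ordering -/

section JumpCopies

theorem Path.pairwise_lt {X : Type} [LinearOrder X] {x y : Ends X} {w : List Bool} {a : List X}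
    (h : Path toEnds Gap x w a y) : a.Pairwise (· < ·) ∧ ∀ z ∈ a, x < toEnds z := by
  induction h with
  | single => simp
  | cons h _ ih =>
    refine ⟨List.pairwise_cons.2 ⟨fun z hz => toEnds_lt.1 (ih.2 z hz), ih.1⟩, ?_⟩
    simp only [List.mem_cons, forall_eq_or_imp]
    exact ⟨h.1, fun z hz => h.1.trans (ih.2 z hz)⟩

variable {L : NatOrdering} {w : List Bool} {a : List ℕ}

theorem Path.lt_iff (h : Path (X := Carrier L) toEnds Gap ⊥ w a ⊤) {i j : ℕ} (hi : i < a.length)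
    (hj : j < a.length) : L.Lt (a.getD i 0) (a.getD j 0) ↔ i < j := by
  have hg : ∀ k, (hk : k < a.length) → a.getD k 0 = a[k] := fun k hk => by simp [hk]
  have hp := List.pairwise_iff_getElem.1 h.pairwise_lt.1
  rw [hg i hi, hg j hj]
  rcases lt_trichotomy i j with hij | rfl | hij
  · exact iff_of_true (hp i j hi hj hij) hij
  · exact iff_of_false (lt_irrefl (α := Carrier L) _) (lt_irrefl _)
  · exact iff_of_false (lt_asymm (α := Carrier L) (hp j i hj hi hij)) hij.le.not_gt

theorem Path.nodup (h : Path (X := Carrier L) toEnds Gap ⊥ w a ⊤) : a.Nodup :=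
  h.pairwise_lt.1.imp fun h => ne_of_lt h

/-- Truth of an atomic formula of the jump at the points with indices `t` in a saturated tuple. -/
def WordRel (w : List Bool) (s : (jumpSignature binarySignature).Sym) (t : List ℕ) : Prop :=
  (∃ u : Unit, s = .inl u ∧ natOrder.Rel () t) ∨
    ∃ p : ℕ × Nat.Partrec.Code, s = .inr p ∧ WordHolds w p.1 p.2 t

theorem jump_rel_iff_wordRel (h : Path (X := Carrier L) toEnds Gap ⊥ w a ⊤)
    {s : (jumpSignature binarySignature).Sym} {t : List ℕ} (ht : ∀ i ∈ t, i < a.length) :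
    (jump L.struc).Rel s (t.map fun i => a.getD i 0) ↔ WordRel w s t := by
  rcases s with u | p
  · have h1 : WordRel w (.inl u) t ↔ natOrder.Rel () t := by
      refine ⟨?_, fun h => .inl ⟨u, rfl, h⟩⟩
      rintro (⟨_, _, h⟩ | ⟨_, e, _⟩)
      · exact h
      · exact nomatch e
    rw [h1]
    change (∃ x y, t.map _ = [x, y] ∧ L.Lt x y) ↔ ∃ x y, t = [x, y] ∧ x < y
    constructor
    · rintro ⟨x, y, e, hxy⟩
      obtain ⟨i, j, rfl⟩ := List.length_eq_two.1 (by simpa using congrArg List.length e)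
      simp only [List.map_cons, List.map_nil, List.cons.injEq, and_true] at e
      obtain ⟨rfl, rfl⟩ := e
      exact ⟨i, j, rfl, (h.lt_iff (ht i (by simp)) (ht j (by simp))).1 hxy⟩
    · rintro ⟨i, j, rfl, hij⟩
      exact ⟨_, _, rfl, (h.lt_iff (ht i (by simp)) (ht j (by simp))).2 hij⟩
  · have h1 : WordRel w (.inr p) t ↔ WordHolds w p.1 p.2 t := by
      refine ⟨?_, fun h => .inr ⟨p, rfl, h⟩⟩
      rintro (⟨_, e, _⟩ | ⟨p', e, h⟩)
      · exact nomatch e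
      · cases e
        exact h
    rw [h1]
    exact sigmaOneHolds_iff_wordHolds h ht

theorem sigOne_wordRel : SigOne fun q : List Bool × (jumpSignature binarySignature).Sym × List ℕ =>
    WordRel q.1 q.2.1 q.2.2 := by
  let A := List Bool × (Unit ⊕ (ℕ × Nat.Partrec.Code)) × List ℕ
  have hs : Primrec fun q : A => q.2.1 := Primrec.fst.comp Primrec.snd
  have ht : Primrec fun q : A => q.2.2 := Primrec.snd.comp Primrec.snd
  have h1 : PrimrecPred fun q : A × Unit => q.1.2.1 = .inl q.2 ∧ natOrder.Rel () q.1.2.2 :=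
    (Primrec.eq.comp (hs.comp Primrec.fst) (Primrec.sumInl.comp Primrec.snd)).and
      (primrecPred_natOrder_rel (ht.comp Primrec.fst))
  have h2 : PrimrecPred fun q : A × (ℕ × Nat.Partrec.Code) => q.1.2.1 = .inr q.2 :=
    Primrec.eq.comp (hs.comp Primrec.fst) (Primrec.sumInr.comp Primrec.snd)
  have h3 : SigOne fun q : A × (ℕ × Nat.Partrec.Code) =>
      WordHolds q.1.1 q.2.1 q.2.2 q.1.2.2 :=
    sigOne_wordHolds.comp_primrec (Primrec.pair (Primrec.fst.comp Primrec.fst)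
      (Primrec.pair (Primrec.fst.comp Primrec.snd)
        (Primrec.pair (Primrec.snd.comp Primrec.snd) (ht.comp Primrec.fst))))
  exact (SigOne.of_primrec h1).ex.or ((SigOne.of_primrec h2).and h3).ex

/-- The number `k` is the code of a true atomic formula, where `x` names the point with index
`σ_x` in a saturated tuple with word `w`. -/
def WordDiagram (w : List Bool) (σ : List ℕ) (k : ℕ) : Prop :=
  ∃ q : (jumpSignature binarySignature).Sym × List ℕ,
    Encodable.encode q = k ∧ WordRel w q.1 (q.2.map fun x => σ.getD x 0)

/-- If `k` is the code of an atomic formula, then its elements are named by `σ`. -/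
def Named (σ : List ℕ) (k : ℕ) : Prop :=
  ∀ q : (jumpSignature binarySignature).Sym × List ℕ, Encodable.encode q = k →
    ∀ x ∈ q.2, x < σ.length

/-- By `hfσ`, element `j` of the copy is the image of the tuple's point with index `σ_j`; `Named`
confines the formula to such elements, where the word decides truth. -/
theorem mem_diagram_iff_wordDiagram (h : Path (X := Carrier L) toEnds Gap ⊥ w a ⊤) {σ : List ℕ}
    (hσ : ∀ i ∈ σ, i < a.length) {B : Struc (jumpSignature binarySignature)} {f : ℕ ≃ ℕ}
    (hf : ∀ s v, (jump L.struc).Rel s v ↔ B.Rel s (v.map f))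
    (hfσ : ∀ j < σ.length, f (a.getD (σ.getD j 0) 0) = j) {k : ℕ} (hk : Named σ k) :
    k ∈ diagram B ↔ WordDiagram w σ k := by
  have key : ∀ q : (jumpSignature binarySignature).Sym × List ℕ, Encodable.encode q = k →
      (B.Rel q.1 q.2 ↔ WordRel w q.1 (q.2.map fun x => σ.getD x 0)) := by
    intro q hq
    rw [← jump_rel_iff_wordRel h, hf]
    · have : ((q.2.map fun x => σ.getD x 0).map fun i => a.getD i 0).map f = q.2 := by
        rw [List.map_map, List.map_map]
        refine (List.map_congr_left fun x hx => ?_).trans (List.map_id _)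
        exact hfσ x (hk q hq x hx)
      rw [this]
    · intro i hi
      obtain ⟨x, hx, rfl⟩ := List.mem_map.1 hi
      refine hσ _ ?_
      have := hk q hq x hx
      simp [List.getD, this]
  constructor
  · rintro ⟨s, v, e, hr⟩
    exact ⟨(s, v), e, (key _ e).1 hr⟩
  · rintro ⟨⟨s, v⟩, e, hr⟩
    exact ⟨s, v, e, (key _ e).2 hr⟩

/-- The segment `p` of the oracle agrees with the diagram given by `w` and `σ`. -/
def SegmentCorrect (w : List Bool) (σ p : List ℕ) : Prop :=
  ∀ k < p.length, Named σ k ∧ ((p.getD k 0 = 1 ∧ WordDiagram w σ k) ∨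
    (p.getD k 0 = 0 ∧ ¬ WordDiagram w σ k))

/-- An entry `1` asserts a `SigOne` fact and an entry `0` the negation of one. Both are `SigTwo`,
and finite conjunctions remain so. -/
theorem sigTwo_segmentCorrect : SigTwo fun q : List Bool × List ℕ × List ℕ =>
    SegmentCorrect q.1 q.2.1 q.2.2 := by
  let A := (List Bool × List ℕ × List ℕ) × ℕ
  let E := (jumpSignature binarySignature).Sym × List ℕ
  have hσ : Primrec fun r : A => r.1.2.1 := Primrec.fst.comp (Primrec.snd.comp Primrec.fst)
  have hp : Primrec fun r : A => r.1.2.2.getD r.2 0 :=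
    (Primrec.list_getD 0).comp (Primrec.snd.comp (Primrec.snd.comp Primrec.fst)) Primrec.snd
  have he : PrimrecPred fun r : A × E => Encodable.encode r.2 = r.1.2 :=
    Primrec.eq.comp (Primrec.encode.comp Primrec.snd) (Primrec.snd.comp Primrec.fst)
  have h1 : SigOne fun r : A => WordDiagram r.1.1 r.1.2.1 r.2 := by
    refine ((SigOne.of_primrec he).and (sigOne_wordRel.comp_primrec
      (f := fun r : A × E => (r.1.1.1, r.2.1, r.2.2.map fun x => r.1.1.2.1.getD x 0)) ?_)).ex
    refine Primrec.pair (Primrec.fst.comp (Primrec.fst.comp Primrec.fst))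
      (Primrec.pair (Primrec.fst.comp Primrec.snd) (Primrec.list_map
        (Primrec.snd.comp Primrec.snd) ?_))
    exact ((Primrec.list_getD 0).comp (hσ.comp (Primrec.fst.comp Primrec.fst)) Primrec.snd).to₂
  have h2 : SigTwo fun r : A => Named r.1.2.1 r.2 := by
    have : PrimrecPred fun r : A × E => ∃ x ∈ r.2.2, ¬ x < r.1.1.2.1.length :=
      primrecPred_exists_mem (Primrec.snd.comp Primrec.snd) (Primrec.nat_lt.comp Primrec.snd
        (Primrec.list_length.comp (hσ.comp (Primrec.fst.comp Primrec.fst)))).not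
    refine (SigTwo.of_not (SigOne.of_primrec (he.and this)).ex).of_iff fun r => ?_
    simp only [Named, not_exists, not_and, not_not]
    exact Iff.rfl
  have h3 : ∀ c : ℕ, SigTwo fun r : A => r.1.2.2.getD r.2 0 = c := fun c =>
    (SigOne.of_primrec (Primrec.eq.comp hp (Primrec.const c))).sigTwo
  exact SigTwo.ball (P := fun (q : List Bool × List ℕ × List ℕ) k => Named q.2.1 k ∧
    ((q.2.2.getD k 0 = 1 ∧ WordDiagram q.1 q.2.1 k) ∨
      (q.2.2.getD k 0 = 0 ∧ ¬ WordDiagram q.1 q.2.1 k)))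
    (h2.and (((h3 1).and h1.sigTwo).or ((h3 0).and (SigTwo.of_not h1))))
    (Primrec.list_length.comp (Primrec.snd.comp Primrec.snd))

theorem exists_perm_of_nodup {l : List ℕ} (hl : l.Nodup) (n : ℕ) (hn : n ≤ l.length) :
    ∃ f : ℕ ≃ ℕ, ∀ j < n, f (l.getD j 0) = j := by
  induction n with
  | zero => exact ⟨Equiv.refl ℕ, by simp⟩
  | succ n ih =>
    obtain ⟨f, hf⟩ := ih (by omega)
    -- The transposition corrects the value at the new entry. It fixes each `j < n`, since `f
    -- (l.getD n 0)` differs from `j` by injectivity of `f` and distinctness of the entries.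
    refine ⟨f.trans (Equiv.swap (f (l.getD n 0)) n), fun j hj => ?_⟩
    rcases Nat.lt_succ_iff_lt_or_eq.1 hj with hj | rfl
    · rw [Equiv.trans_apply, hf j hj, Equiv.swap_apply_of_ne_of_ne _ hj.ne]
      rw [← hf j hj]
      intro e
      have := f.injective e
      rw [List.getD_eq_getElem _ _ (by omega), List.getD_eq_getElem _ _ (by omega)] at this
      exact hj.ne ((hl.getElem_inj_iff).1 this)
    · rw [Equiv.trans_apply, Equiv.swap_apply_left]

/-- The structure transported along a permutation. -/
def Struc.map {τ : Signature} (A : Struc τ) (f : ℕ ≃ ℕ) : Struc τ where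
  Rel s v := A.Rel s (v.map f.symm)
  length_eq s v h := by simpa using A.length_eq s _ h

theorem Struc.map_rel {τ : Signature} (A : Struc τ) (f : ℕ ≃ ℕ) (s : τ.Sym) (v : List ℕ) :
    A.Rel s v ↔ (A.map f).Rel s (v.map f) := by
  simp [Struc.map, Function.comp_def]

theorem exists_path_idxOf (L : NatOrdering) (F : Finset ℕ) :
    ∃ (w : List Bool) (a : List ℕ), Path (X := Carrier L) toEnds Gap ⊥ w a ⊤ ∧
      ∀ z ∈ F, a.idxOf z < a.length := by
  obtain ⟨w, a, h, ha⟩ := exists_path (X := Carrier L) F (x := ⊥) (y := ⊤) bot_lt_top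
    fun z _ => ⟨bot_lt_toEnds z, toEnds_lt_top z⟩
  exact ⟨w, a, h, fun z hz => List.idxOf_lt_length_iff.2 (ha z hz)⟩

theorem getD_idxOf {a : List ℕ} {z : ℕ} (h : a.idxOf z < a.length) :
    a.getD (a.idxOf z) 0 = z := by
  rw [List.getD_eq_getElem _ _ h, List.getElem_idxOf h]

theorem primrecPred_nodup : PrimrecPred fun l : List ℕ => l.Nodup := by
  have h : PrimrecPred fun l : List ℕ =>
      ∀ i < l.length, ∀ j < i, l.getD j 0 ≠ l.getD i 0 := by
    refine primrecPred_forall_lt (R := fun (l : List ℕ) i => ∀ j < i, l.getD j 0 ≠ l.getD i 0)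
      (primrecPred_forall_lt (R := fun (q : List ℕ × ℕ) j => q.1.getD j 0 ≠ q.1.getD q.2 0)
        (Primrec.eq.comp ?_ ?_).not Primrec.snd) Primrec.list_length
    · exact (Primrec.list_getD 0).comp (Primrec.fst.comp Primrec.fst) Primrec.snd
    · exact (Primrec.list_getD 0).comp (Primrec.fst.comp Primrec.fst)
        (Primrec.snd.comp Primrec.fst)
  refine h.of_eq fun l => ?_
  rw [List.Nodup, List.pairwise_iff_getElem]
  constructor
  · intro H i j hi hj hij
    simpa [hi, hj] using H j hj i hij
  · intro H j hj i hij
    have hi := hij.trans hj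
    simpa [hi, hj] using H i j hi hj hij

/-- Only finitely many atomic formulas have codes below `M`; `J` bounds the elements they mention.
-/
theorem exists_named (M : ℕ) : ∃ J, ∀ σ : List ℕ, σ.length = J → ∀ k < M, Named σ k := by
  obtain ⟨J, hJ⟩ := exists_forall_lt_of_mono (n := M)
    (P := fun k J => ∀ q : (jumpSignature binarySignature).Sym × List ℕ,
      Encodable.encode q = k → ∀ x ∈ q.2, x < J)
    (fun k J J' hJ h q hq x hx => (h q hq x hx).trans_le hJ) fun k _ => by
      by_cases h : ∃ q : (jumpSignature binarySignature).Sym × List ℕ, Encodable.encode q = k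
      · obtain ⟨q, hq⟩ := h
        refine ⟨q.2.sum + 1, fun q' hq' x hx => ?_⟩
        obtain rfl := Encodable.encode_injective (hq'.trans hq.symm)
        exact Nat.lt_succ_of_le (List.le_sum_of_mem hx)
      · exact ⟨0, fun q hq => absurd ⟨q, hq⟩ h⟩
  exact ⟨J, fun σ hσ k hk q hq x hx => hσ ▸ hJ k hk q hq x hx⟩

theorem segment_length (g : ℕ → ℕ) (M : ℕ) : (segment g M).length = M := by simp [segment]

theorem segment_getD {g : ℕ → ℕ} {M k : ℕ} (hk : k < M) : (segment g M).getD k 0 = g k := by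
  simp [segment, hk]

/-- Given a cycle, run the operator on the jump itself and take a saturated tuple through all
elements mentioned in the segment used. Conversely, if the guessed `w`, `σ`, `p` are correct, a
permutation moves the named points to `0, 1, …` and yields a copy of the jump whose diagram begins
with `p`. On this copy the operator outputs a copy of `A`, which contains the cycle computed from
`p`. -/
theorem hasCycle_iff_word {A : Struc binarySignature} {c : OracleCode}
    (hc : ∀ B' : Struc (jumpSignature binarySignature), IsCopy (jump L.struc) B' →
      ∃ A' : Struc binarySignature, IsCopy A A' ∧
        ∀ n, c.eval (chi (diagram B')) n = Part.some (chi (diagram A') n)) {k : ℕ} :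
    HasCycle A k ↔ ∃ q : List Bool × List ℕ × List ℕ,
      ((PathWord (X := Carrier L) ⊥ q.1 ⊤ ∧ SegmentCycle c q.2.2 k) ∧
        (q.2.1.Nodup ∧ ∀ i ∈ q.2.1, i + 1 < q.1.length)) ∧ SegmentCorrect q.1 q.2.1 q.2.2 := by
  constructor
  · intro hA
    obtain ⟨A', hA', hcA⟩ := hc (jump L.struc) ⟨Equiv.refl ℕ, fun s v => by simp⟩
    obtain ⟨M, hM⟩ := (hasCycle_iff_segmentCycle hcA).1 (hA'.hasCycle.1 hA)
    obtain ⟨J, hJ⟩ := exists_named M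
    obtain ⟨w, a, h, ha⟩ := exists_path_idxOf L (Finset.range J)
    have ha' : ∀ j < J, a.idxOf j < a.length := fun j hj => ha j (Finset.mem_range.2 hj)
    have hσ : ∀ i ∈ (List.range J).map a.idxOf, i < a.length := by
      intro i hi
      obtain ⟨j, hj, rfl⟩ := List.mem_map.1 hi
      exact ha' j (List.mem_range.1 hj)
    have hl : w.length = a.length + 1 := h.length_eq
    refine ⟨(w, (List.range J).map a.idxOf, segment (chi (diagram (jump L.struc))) M),
      ⟨⟨⟨a, h⟩, hM⟩, ?_, fun i hi => ?_⟩, fun k hk => ?_⟩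
    · refine List.Nodup.map_on (fun x hx y hy e => ?_) List.nodup_range
      rw [← getD_idxOf (ha' x (List.mem_range.1 hx)), e,
        getD_idxOf (ha' y (List.mem_range.1 hy))]
    · have := hσ i hi
      simp only [hl]
      omega
    · rw [segment_length] at hk
      have hN := hJ ((List.range J).map a.idxOf) (by simp) k hk
      refine ⟨hN, ?_⟩
      have hd := mem_diagram_iff_wordDiagram h hσ (B := jump L.struc) (f := Equiv.refl ℕ)
        (fun s v => by simp) (fun j hj => ?_) hN
      · rw [segment_getD hk, chi_eq_one, chi_eq_zero, hd]
        tauto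
      · have hj' : j < J := by simpa using hj
        simpa [hj'] using getD_idxOf (ha' j hj')
  · rintro ⟨⟨w, σ, p⟩, ⟨⟨hw, hp⟩, hσ, hσ'⟩, hcor⟩
    obtain ⟨a, h⟩ : ∃ a : List ℕ, Path (X := Carrier L) toEnds Gap ⊥ w a ⊤ := hw
    simp only at hp hσ hσ' hcor
    have hl : w.length = a.length + 1 := h.length_eq
    have hσa : ∀ i ∈ σ, i < a.length := fun i hi => by
      have := hσ' i hi
      omega
    have hnd : (σ.map fun i => a.getD i 0).Nodup := by
      refine hσ.map_on fun x hx y hy e => ?_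
      rw [List.getD_eq_getElem _ _ (hσa x hx), List.getD_eq_getElem _ _ (hσa y hy)] at e
      exact (h.nodup.getElem_inj_iff).1 e
    obtain ⟨f, hf⟩ := exists_perm_of_nodup hnd σ.length (by simp)
    obtain ⟨A', hA', hcA⟩ := hc ((jump L.struc).map f) ⟨f, Struc.map_rel _ f⟩
    refine hA'.hasCycle.2 ((hasCycle_iff_segmentCycle hcA).2 ⟨p.length, ?_⟩)
    have hseg : segment (chi (diagram ((jump L.struc).map f))) p.length = p := by
      refine List.ext_getElem (segment_length _ _) fun k hk hk' => ?_
      obtain ⟨hN, hk1⟩ := hcor k hk'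
      have hd := mem_diagram_iff_wordDiagram h hσa (Struc.map_rel _ f) (fun j hj => by
        simpa [hj] using hf j hj) hN
      rw [← List.getD_eq_getElem _ 0 hk, ← List.getD_eq_getElem _ 0 hk', segment_getD hk']
      rcases hk1 with ⟨e, hk1⟩ | ⟨e, hk1⟩
      · exact (chi_eq_one.2 (hd.2 hk1)).trans e.symm
      · exact (chi_eq_zero.2 fun h => hk1 (hd.1 h)).trans e.symm
    rw [hseg]
    exact hp

theorem sigTwo_hasCycle_of_medvedevReducible {A : Struc binarySignature}
    (h : MedvedevReducible A (jump L.struc)) : SigTwo fun k => HasCycle A k := by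
  obtain ⟨c, hc⟩ := h
  let E := List Bool × List ℕ × List ℕ
  have hσ : Primrec fun r : ℕ × E => r.2.2.1 := Primrec.fst.comp (Primrec.snd.comp Primrec.snd)
  have hw : Primrec fun r : ℕ × E => r.2.1 := Primrec.fst.comp Primrec.snd
  have h1 : SigOne fun r : ℕ × E => PathWord (X := Carrier L) ⊥ r.2.1 ⊤ :=
    sigOne_pathWord.comp_primrec hw
  have h2 : SigOne fun r : ℕ × E => SegmentCycle c r.2.2.2 r.1 :=
    (sigOne_segmentCycle c).comp_primrec (Primrec.pair
      (Primrec.snd.comp (Primrec.snd.comp Primrec.snd)) Primrec.fst)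
  have h3 : PrimrecPred fun r : ℕ × E => r.2.2.1.Nodup ∧ ∀ i ∈ r.2.2.1, i + 1 < r.2.1.length :=
    (primrecPred_nodup.comp hσ).and (primrecPred_forall_mem hσ (Primrec.nat_lt.comp
      (Primrec.succ.comp Primrec.snd) (Primrec.list_length.comp (hw.comp Primrec.fst))))
  have h4 : SigTwo fun r : ℕ × E => SegmentCorrect r.2.1 r.2.2.1 r.2.2.2 :=
    sigTwo_segmentCorrect.comp Computable.snd
  exact (((h1.and h2).and (SigOne.of_primrec h3)).sigTwo.and h4).ex.of_iff
    fun k => hasCycle_iff_word hc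

end JumpCopies

/-! ### Interpretations by computable `Σ₂` formulas -/

section Interpretations

variable {L : NatOrdering} {w : List Bool} {a : List ℕ}

/-- The truth of a computable `Σ₂` formula at the points with indices `t` in a saturated tuple,
with witnesses in the tuple. -/
def WordHoldsTwo (w : List Bool) (n : ℕ) (e : Nat.Partrec.Code) (t : List ℕ) : Prop :=
  ∃ q : (ℕ × Nat.Partrec.Code) × List ℕ, (InCE e q.1 ∧ (t.length = n ∧ q.2.length = q.1.1 ∧
    ∀ i ∈ q.2, i + 1 < w.length)) ∧ ¬ WordHolds w (n + q.1.1) q.1.2 (t ++ q.2)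

theorem sigTwo_wordHoldsTwo : SigTwo fun p : List Bool × ℕ × Nat.Partrec.Code × List ℕ =>
    WordHoldsTwo p.1 p.2.1 p.2.2.1 p.2.2.2 := by
  let A := List Bool × ℕ × Nat.Partrec.Code × List ℕ
  let E := (ℕ × Nat.Partrec.Code) × List ℕ
  have hw : Primrec fun p : A × E => p.1.1 := Primrec.fst.comp Primrec.fst
  have hn : Primrec fun p : A × E => p.1.2.1 :=
    Primrec.fst.comp (Primrec.snd.comp Primrec.fst)
  have he : Primrec fun p : A × E => p.1.2.2.1 :=
    Primrec.fst.comp (Primrec.snd.comp (Primrec.snd.comp Primrec.fst))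
  have ht : Primrec fun p : A × E => p.1.2.2.2 :=
    Primrec.snd.comp (Primrec.snd.comp (Primrec.snd.comp Primrec.fst))
  have hq : Primrec fun p : A × E => p.2.1 := Primrec.fst.comp Primrec.snd
  have hb : Primrec fun p : A × E => p.2.2 := Primrec.snd.comp Primrec.snd
  have h1 : SigOne fun p : A × E => InCE p.1.2.2.1 p.2.1 :=
    sigOne_inCE.comp_primrec (Primrec.pair he hq)
  have h2 : PrimrecPred fun p : A × E => p.1.2.2.2.length = p.1.2.1 ∧
      p.2.2.length = p.2.1.1 ∧ ∀ i ∈ p.2.2, i + 1 < p.1.1.length :=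
    (Primrec.eq.comp (Primrec.list_length.comp ht) hn).and
      ((Primrec.eq.comp (Primrec.list_length.comp hb) (Primrec.fst.comp hq)).and
        (primrecPred_forall_mem hb (Primrec.nat_lt.comp (Primrec.succ.comp Primrec.snd)
          (Primrec.list_length.comp (hw.comp Primrec.fst)))))
  have h3 : SigOne fun p : A × E =>
      WordHolds p.1.1 (p.1.2.1 + p.2.1.1) p.2.1.2 (p.1.2.2.2 ++ p.2.2) :=
    sigOne_wordHolds.comp_primrec (Primrec.pair hw (Primrec.pair
      (Primrec.nat_add.comp hn (Primrec.fst.comp hq)) (Primrec.pair (Primrec.snd.comp hq)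
        (Primrec.list_append.comp ht hb))))
  exact ((h1.and (SigOne.of_primrec h2)).sigTwo.and (SigTwo.of_not h3)).ex

theorem WordHoldsTwo.sigmaTwoHolds (h : Path (X := Carrier L) toEnds Gap ⊥ w a ⊤) {n : ℕ}
    {e : Nat.Partrec.Code} {t : List ℕ} (ht : ∀ i ∈ t, i < a.length)
    (H : WordHoldsTwo w n e t) : SigmaTwoHolds L.struc n e (t.map fun i => a.getD i 0) := by
  obtain ⟨⟨⟨m, d⟩, b⟩, ⟨he, hn, hb, hbw⟩, hh⟩ := H
  have hl : w.length = a.length + 1 := h.length_eq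
  refine ⟨by simpa using hn, m, d, he, b.map fun i => a.getD i 0, by simpa using hb, ?_⟩
  rwa [← List.map_append, sigmaOneHolds_iff_wordHolds h]
  intro i hi
  rcases List.mem_append.1 hi with hi | hi
  · exact ht i hi
  · have := hbw i hi
    omega

theorem map_getD_idxOf {x : List ℕ} (hx : ∀ z ∈ x, a.idxOf z < a.length) :
    (x.map a.idxOf).map (fun i => a.getD i 0) = x := by
  rw [List.map_map]
  exact (List.map_congr_left fun z hz => getD_idxOf (hx z hz)).trans (List.map_id _)

/-- `F` consists of the arguments and the existential witnesses. Since every saturated tuple through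
`F` works, one tuple can later serve many instances at once. -/
theorem SigmaTwoHolds.exists_finset {n : ℕ} {e : Nat.Partrec.Code} {x : List ℕ}
    (H : SigmaTwoHolds L.struc n e x) : ∃ F : Finset ℕ, ∀ (w : List Bool) (a : List ℕ),
      Path (X := Carrier L) toEnds Gap ⊥ w a ⊤ → (∀ z ∈ F, a.idxOf z < a.length) →
        (∀ z ∈ x, a.idxOf z < a.length) ∧ WordHoldsTwo w n e (x.map a.idxOf) := by
  obtain ⟨hn, m, d, he, b, hb, hh⟩ := H
  refine ⟨(x ++ b).toFinset, fun w a h hF => ?_⟩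
  have hF' : ∀ z ∈ x ++ b, a.idxOf z < a.length := fun z hz => hF z (List.mem_toFinset.2 hz)
  have hl : w.length = a.length + 1 := h.length_eq
  refine ⟨fun z hz => hF' z (List.mem_append_left _ hz), ⟨(m, d), b.map a.idxOf⟩,
    ⟨he, by simpa using hn, by simpa using hb, fun i hi => ?_⟩, ?_⟩
  · obtain ⟨z, hz, rfl⟩ := List.mem_map.1 hi
    have := hF' z (List.mem_append_right _ hz)
    omega
  · rwa [← List.map_append, ← sigmaOneHolds_iff_wordHolds h, map_getD_idxOf hF']
    intro i hi
    obtain ⟨z, hz, rfl⟩ := List.mem_map.1 hi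
    exact hF' z hz

/-- The truth of the formula given by `f` at a tuple of tuples of indices. -/
def WordDefines (f : List ℕ → Nat.Partrec.Code) (w : List Bool) (t : List (List ℕ)) : Prop :=
  WordHoldsTwo w (t.map List.length).sum (f (t.map List.length)) t.flatten

theorem sigTwo_wordDefines {f : List ℕ → Nat.Partrec.Code} (hf : Computable f) :
    SigTwo fun p : List Bool × List (List ℕ) => WordDefines f p.1 p.2 := by
  have hl : Primrec fun p : List Bool × List (List ℕ) => p.2.map List.length :=
    Primrec.list_map Primrec.snd (Primrec.list_length.comp Primrec.snd).to₂
  have hs : Primrec fun l : List ℕ => l.sum :=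
    Primrec.list_foldr Primrec.id (Primrec.const 0)
      (h := fun (_ : List ℕ) (p : ℕ × ℕ) => p.1 + p.2) (Primrec.nat_add.comp
        (Primrec.fst.comp Primrec.snd) (Primrec.snd.comp Primrec.snd)).to₂
  exact sigTwo_wordHoldsTwo.comp (f := fun p : List Bool × List (List ℕ) =>
    (p.1, (p.2.map List.length).sum, f (p.2.map List.length), p.2.flatten))
    (Computable.pair Computable.fst (Computable.pair (hs.comp hl).to_comp
      (Computable.pair (hf.comp hl.to_comp) (Primrec.list_flatten.comp Primrec.snd).to_comp)))

/-- The relation between tuples of arbitrary lengths defined by `f`. -/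
def Defines (L : NatOrdering) (f : List ℕ → Nat.Partrec.Code) (t : List (List ℕ)) : Prop :=
  SigmaTwoHolds L.struc (t.map List.length).sum (f (t.map List.length)) t.flatten

theorem WordDefines.defines (h : Path (X := Carrier L) toEnds Gap ⊥ w a ⊤)
    {f : List ℕ → Nat.Partrec.Code} {t : List (List ℕ)} (ht : ∀ l ∈ t, ∀ i ∈ l, i < a.length)
    (H : WordDefines f w t) : Defines L f (t.map fun l => l.map fun i => a.getD i 0) := by
  have e : (t.map fun l => l.map fun i => a.getD i 0).map List.length = t.map List.length := by
    rw [List.map_map]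
    exact List.map_congr_left fun l _ => by simp
  rw [Defines, e, ← List.map_flatten]
  refine H.sigmaTwoHolds h fun i hi => ?_
  obtain ⟨l, hl, hi⟩ := List.mem_flatten.1 hi
  exact ht l hl i hi

theorem Defines.exists_finset {f : List ℕ → Nat.Partrec.Code} {t : List (List ℕ)}
    (H : Defines L f t) : ∃ F : Finset ℕ, ∀ (w : List Bool) (a : List ℕ),
      Path (X := Carrier L) toEnds Gap ⊥ w a ⊤ → (∀ z ∈ F, a.idxOf z < a.length) →
        (∀ l ∈ t, ∀ z ∈ l, a.idxOf z < a.length) ∧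
          WordDefines f w (t.map fun l => l.map a.idxOf) := by
  obtain ⟨F, hF⟩ := SigmaTwoHolds.exists_finset H
  refine ⟨F, fun w a h hFa => ?_⟩
  obtain ⟨h1, h2⟩ := hF w a h hFa
  refine ⟨fun l hl z hz => h1 z (List.mem_flatten.2 ⟨l, hl, hz⟩), ?_⟩
  have e : (t.map fun l => l.map a.idxOf).map List.length = t.map List.length := by
    rw [List.map_map]
    exact List.map_congr_left fun l _ => by simp
  rw [WordDefines, e, ← List.map_flatten]
  exact h2

/-- A cycle in the quotient amounts to representatives that are pairwise inequivalent and
successively related; inequivalence is itself $\Sigma_2$ definable. -/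
theorem hasCycle_iff_defines {A : Struc binarySignature} (I : SigmaTwoInterpretation A L.struc)
    {f g : List ℕ → Nat.Partrec.Code}
    (hf : ∀ t, (∃ a b : I.D, t = [a.1, b.1] ∧ ¬ I.sim a b) ↔ Defines L f t)
    (hg : ∀ t, (∃ u : List I.D, t = u.map Subtype.val ∧ I.Rel () u) ↔ Defines L g t) {k : ℕ} :
    HasCycle A k ↔ ∃ v : ℕ → List ℕ, (∀ i < k, ∀ j < i, Defines L f [v j, v i]) ∧
      ∀ i < k, Defines L g [v i, v ((i + 1) % k)] := by
  constructor
  · rintro ⟨v, hv, hv'⟩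
    choose s hs using I.π_surjective
    refine ⟨fun i => (s (v i)).1, fun i hi j hj => (hf _).1 ⟨_, _, rfl, fun h => ?_⟩,
      fun i hi => (hg _).1 ⟨[s (v i), s (v ((i + 1) % k))], rfl, ?_⟩⟩
    · rw [← I.π_eq_iff, hs, hs] at h
      exact hv i hi j hj h
    · exact (I.π_rel () _).2 (by simpa [hs] using hv' i hi)
  · rintro ⟨v, hv, hv'⟩
    -- Membership in the domain is implied by the edges, since each `v i` occurs in a related pair.
    have hD : ∀ i < k, v i ∈ I.D := by
      intro i hi
      obtain ⟨u, hu, -⟩ := (hg _).2 (hv' i hi)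
      have : v i ∈ u.map Subtype.val := hu ▸ List.mem_cons_self
      obtain ⟨d, -, hd⟩ := List.mem_map.1 this
      exact hd ▸ d.2
    classical
    refine ⟨fun i => if h : v i ∈ I.D then I.π ⟨v i, h⟩ else 0, fun i hi j hj => ?_,
      fun i hi => ?_⟩
    · obtain ⟨d, d', e, hs⟩ := (hf _).2 (hv i hi j hj)
      simp only [List.cons.injEq, and_true] at e
      simp only [dif_pos (hD i hi), dif_pos (hD j (hj.trans hi))]
      rw [Ne, I.π_eq_iff]
      simpa only [e.1, e.2] using hs
    · have hi' : (i + 1) % k < k := Nat.mod_lt _ (by omega)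
      obtain ⟨u, hu, hr⟩ := (hg _).2 (hv' i hi)
      obtain ⟨d, d', rfl⟩ := List.length_eq_two.1
        (by simpa using (congrArg List.length hu).symm : u.length = 2)
      simp only [List.map_cons, List.map_nil, List.cons.injEq, and_true] at hu
      simp only [dif_pos (hD i hi), dif_pos (hD _ hi')]
      have hr : A.Rel () [I.π d, I.π d'] := (I.π_rel () _).1 hr
      simpa only [hu.1, hu.2] using hr

/-- Finitely many formula instances are involved, so one saturated tuple passes through the elements
needed for all of them. The right-hand side refers to the ordering only through the set of realized
words. -/
theorem exists_defines_iff_word {f g : List ℕ → Nat.Partrec.Code} {k : ℕ} :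
    (∃ v : ℕ → List ℕ, (∀ i < k, ∀ j < i, Defines L f [v j, v i]) ∧
      ∀ i < k, Defines L g [v i, v ((i + 1) % k)]) ↔
    ∃ q : List Bool × List (List ℕ), (PathWord (X := Carrier L) ⊥ q.1 ⊤ ∧
      ∀ l ∈ q.2, ∀ i ∈ l, i + 1 < q.1.length) ∧
      ((∀ i < k, ∀ j < i, WordDefines f q.1 [q.2.getD j [], q.2.getD i []]) ∧
        ∀ i < k, WordDefines g q.1 [q.2.getD i [], q.2.getD ((i + 1) % k) []]) := by
  classical
  constructor
  · rintro ⟨v, hv, hv'⟩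
    choose! F hF using fun i hi j hj => (hv i hi j hj).exists_finset
    choose! F' hF' using fun i hi => (hv' i hi).exists_finset
    obtain ⟨w, a, h, ha⟩ := exists_path_idxOf L
      (((Finset.range k).biUnion fun i => (Finset.range k).biUnion (F i)) ∪
        (Finset.range k).biUnion F')
    have h1 : ∀ i < k, ∀ j < i, ∀ z ∈ F i j, a.idxOf z < a.length := fun i hi j hj z hz =>
      ha z (Finset.mem_union_left _ (Finset.mem_biUnion.2 ⟨i, Finset.mem_range.2 hi,
        Finset.mem_biUnion.2 ⟨j, Finset.mem_range.2 (hj.trans hi), hz⟩⟩))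
    have h2 : ∀ i < k, ∀ z ∈ F' i, a.idxOf z < a.length := fun i hi z hz =>
      ha z (Finset.mem_union_right _ (Finset.mem_biUnion.2 ⟨i, Finset.mem_range.2 hi, hz⟩))
    have hl : w.length = a.length + 1 := h.length_eq
    have hg : ∀ i < k, ((List.range k).map fun i => (v i).map a.idxOf).getD i [] =
        (v i).map a.idxOf := fun i hi => by simp [hi]
    refine ⟨(w, (List.range k).map fun i => (v i).map a.idxOf), ⟨⟨a, h⟩, fun l hl' i hi => ?_⟩,
      fun i hi j hj => ?_, fun i hi => ?_⟩
    · obtain ⟨j, hj, rfl⟩ := List.mem_map.1 hl'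
      obtain ⟨z, hz, rfl⟩ := List.mem_map.1 hi
      have hj := List.mem_range.1 hj
      have := (hF' j hj w a h (h2 j hj)).1 (v j) (by simp) z hz
      simp only [hl]
      omega
    · simp only [hg i hi, hg j (hj.trans hi)]
      exact (hF i hi j hj w a h (h1 i hi j hj)).2
    · simp only [hg i hi, hg _ (Nat.mod_lt (i + 1) (show k > 0 by omega))]
      exact (hF' i hi w a h (h2 i hi)).2
  · rintro ⟨⟨w, t⟩, ⟨hw, ht⟩, hv, hv'⟩
    obtain ⟨a, h⟩ : ∃ a : List ℕ, Path (X := Carrier L) toEnds Gap ⊥ w a ⊤ := hw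
    simp only at ht hv hv'
    have hl : w.length = a.length + 1 := h.length_eq
    have ht' : ∀ i, ∀ x ∈ t.getD i [], x < a.length := by
      intro i x hx
      by_cases hi : i < t.length
      · rw [List.getD_eq_getElem _ _ hi] at hx
        have := ht _ (List.getElem_mem hi) x hx
        omega
      · rw [List.getD_eq_default _ _ (by omega)] at hx
        simp at hx
    have ht2 : ∀ i j, ∀ l ∈ [t.getD i [], t.getD j []], ∀ x ∈ l, x < a.length := by
      intro i j l hl
      simp only [List.mem_cons, List.not_mem_nil, or_false] at hl
      rcases hl with rfl | rfl
      · exact ht' i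
      · exact ht' j
    exact ⟨fun i => (t.getD i []).map fun x => a.getD x 0,
      fun i hi j hj => (hv i hi j hj).defines h (ht2 j i),
      fun i hi => (hv' i hi).defines h (ht2 i _)⟩

theorem sigTwo_hasCycle_of_isSigmaTwoInterpreted {A : Struc binarySignature}
    (h : IsSigmaTwoInterpreted A L.struc) : SigTwo fun k => HasCycle A k := by
  obtain ⟨I⟩ := h
  obtain ⟨f, hf, hf'⟩ := I.not_sim_def
  obtain ⟨g, hg, hg'⟩ := I.rel_def
  have hfc : Computable (f ()) := hf.comp (Computable.const ()) Computable.id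
  have hgc : Computable (g ()) := hg.comp (Computable.const (() : Unit)) Computable.id
  let E := ℕ × (List Bool × List (List ℕ))
  have hw : Primrec fun r : E => r.2.1 := Primrec.fst.comp Primrec.snd
  have ht : Primrec fun r : E => r.2.2 := Primrec.snd.comp Primrec.snd
  have h1 : SigOne fun r : E => PathWord (X := Carrier L) ⊥ r.2.1 ⊤ :=
    sigOne_pathWord.comp_primrec hw
  have h2 : PrimrecPred fun r : E => ∀ l ∈ r.2.2, ∀ i ∈ l, i + 1 < r.2.1.length :=
    primrecPred_forall_mem ht (primrecPred_forall_mem Primrec.snd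
      (Primrec.nat_lt.comp (Primrec.succ.comp Primrec.snd)
        (Primrec.list_length.comp (hw.comp (Primrec.fst.comp Primrec.fst)))))
  have hpair : ∀ {B : Type} [Primcodable B] {x y : B → List ℕ}, Primrec x → Primrec y →
      Primrec fun b => [x b, y b] := fun hx hy =>
    Primrec.list_cons.comp hx (Primrec.list_cons.comp hy (Primrec.const []))
  have hi : Primrec fun r : E × ℕ => r.1.2.2.getD r.2 [] :=
    (Primrec.list_getD []).comp (ht.comp Primrec.fst) Primrec.snd
  have h3 : SigTwo fun r : E => ∀ i < r.1, ∀ j < i,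
      WordDefines (f ()) r.2.1 [r.2.2.getD j [], r.2.2.getD i []] := by
    refine SigTwo.ball (P := fun (r : E) i => ∀ j < i,
      WordDefines (f ()) r.2.1 [r.2.2.getD j [], r.2.2.getD i []]) (SigTwo.ball
      (P := fun (r : E × ℕ) j => WordDefines (f ()) r.1.2.1 [r.1.2.2.getD j [],
        r.1.2.2.getD r.2 []]) ?_ Primrec.snd) Primrec.fst
    refine (sigTwo_wordDefines hfc).comp (Primrec.pair
      (hw.comp (Primrec.fst.comp Primrec.fst)) (hpair ?_ (hi.comp Primrec.fst))).to_comp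
    exact hi.comp (Primrec.pair (Primrec.fst.comp Primrec.fst) Primrec.snd)
  have h4 : SigTwo fun r : E => ∀ i < r.1,
      WordDefines (g ()) r.2.1 [r.2.2.getD i [], r.2.2.getD ((i + 1) % r.1) []] := by
    refine SigTwo.ball (P := fun (r : E) i =>
      WordDefines (g ()) r.2.1 [r.2.2.getD i [], r.2.2.getD ((i + 1) % r.1) []])
      ((sigTwo_wordDefines hgc).comp (Primrec.pair (hw.comp Primrec.fst)
        (hpair hi ?_)).to_comp) Primrec.fst
    exact hi.comp (Primrec.pair Primrec.fst (Primrec.nat_mod.comp (Primrec.succ.comp Primrec.snd)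
      (Primrec.fst.comp Primrec.fst)))
  exact ((h1.and (SigOne.of_primrec h2)).sigTwo.and (h3.and h4)).ex.of_iff fun k =>
    (hasCycle_iff_defines I (hf' ()) (hg' ())).trans exists_defines_iff_word

end Interpretations

/-! ### Disjoint unions of cycles -/

section Graphs

/-- The disjoint union of cycles of lengths `ℓ 0, ℓ 1, …` and infinitely many isolated points. The
`i`-th vertex of the `n`-th cycle is the pair `(n, i)`. -/
def cycleUnion (ℓ : ℕ → ℕ) : SimpleGraph ℕ := SimpleGraph.fromRel fun x y =>
  x.unpair.1 = y.unpair.1 ∧ x.unpair.2 < ℓ x.unpair.1 ∧ y.unpair.2 < ℓ x.unpair.1 ∧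
    (y.unpair.2 : ZMod (ℓ x.unpair.1)) = x.unpair.2 + 1

theorem binaryStruc_rel {r : ℕ → ℕ → Prop} {x y : ℕ} :
    (binaryStruc r).Rel () [x, y] ↔ r x y := by
  constructor
  · rintro ⟨a, b, e, h⟩
    simp only [List.cons.injEq, and_true] at e
    rwa [e.1, e.2]
  · exact fun h => ⟨x, y, rfl, h⟩

theorem hasCycle_cycleUnion_of_eq {ℓ : ℕ → ℕ} {n : ℕ} (hn : 3 ≤ ℓ n) :
    HasCycle (ofGraph (cycleUnion ℓ)) (ℓ n) := by
  refine ⟨fun i => Nat.pair n i, fun i _ j hj e => hj.ne (Nat.pair_eq_pair.1 e).2, fun i hi => ?_⟩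
  have hi' : (i + 1) % ℓ n < ℓ n := Nat.mod_lt _ (by omega)
  refine binaryStruc_rel.2 ((SimpleGraph.fromRel_adj _ _ _).2 ⟨fun e => ?_, .inl ?_⟩)
  · have e := (Nat.pair_eq_pair.1 e).2
    rcases eq_or_lt_of_le (Nat.succ_le_of_lt hi) with h | h
    · rw [← h, Nat.succ_eq_add_one, Nat.mod_self] at e
      omega
    · rw [Nat.mod_eq_of_lt h] at e
      omega
  · rw [Nat.unpair_pair, Nat.unpair_pair]
    exact ⟨rfl, hi, hi', by simp⟩

/-- The cycle stays in one component, where it is a walk in `ZMod (ℓ n)` with steps `1` or `-1`. It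
cannot turn back because `k ≥ 3`, so its step is constant, and it returns to its start exactly at
the multiples of `ℓ n`. Hence `ℓ n` and `k` divide each other. -/
theorem exists_eq_of_hasCycle_cycleUnion {ℓ : ℕ → ℕ} {k : ℕ} (hk : 3 ≤ k)
    (h : HasCycle (ofGraph (cycleUnion ℓ)) k) : ∃ n, ℓ n = k := by
  obtain ⟨v, hv, hv'⟩ := h
  have hk0 : 0 < k := by omega
  -- The cycle is extended periodically, so that induction along it needs no wrap-around case.
  let W : ℕ → ℕ := fun i => v (i % k)
  have hWinj : ∀ i j, W i = W j → i % k = j % k := by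
    intro i j e
    rcases lt_trichotomy (i % k) (j % k) with h | h | h
    · exact absurd e (hv _ (Nat.mod_lt _ hk0) _ h)
    · exact h
    · exact absurd e.symm (hv _ (Nat.mod_lt _ hk0) _ h)
  have hadj : ∀ i, (cycleUnion ℓ).Adj (W i) (W (i + 1)) := by
    intro i
    have := binaryStruc_rel.1 (hv' (i % k) (Nat.mod_lt _ hk0))
    rwa [Nat.mod_add_mod] at this
  obtain ⟨n, hn⟩ : ∃ n, (W 0).unpair.1 = n := ⟨_, rfl⟩
  have hW : ∀ i, (W i).unpair.1 = n := by
    intro i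
    induction i with
    | zero => exact hn
    | succ i ih =>
      obtain ⟨-, ⟨e, -⟩ | ⟨e, -⟩⟩ := (SimpleGraph.fromRel_adj _ _ _).1 (hadj i)
      · rw [← e, ih]
      · rw [e, ih]
  have hstep : ∀ i, (W i).unpair.2 < ℓ n ∧
      (((W (i + 1)).unpair.2 : ZMod (ℓ n)) = (W i).unpair.2 + 1 ∨
        ((W (i + 1)).unpair.2 : ZMod (ℓ n)) = (W i).unpair.2 + -1) := by
    intro i
    obtain ⟨-, ⟨-, h1, -, h2⟩ | ⟨-, -, h1, h2⟩⟩ := (SimpleGraph.fromRel_adj _ _ _).1 (hadj i)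
    · rw [hW i] at h1 h2
      exact ⟨h1, .inl h2⟩
    · rw [hW (i + 1)] at h1 h2
      exact ⟨h1, .inr (by rw [h2]; ring)⟩
  let u : ℕ → ZMod (ℓ n) := fun i => ((W i).unpair.2 : ZMod (ℓ n))
  have hu : ∀ i, u (i + 1) = u i + 1 ∨ u (i + 1) = u i + -1 := fun i => (hstep i).2
  have huinj : ∀ i j, u i = u j → i % k = j % k := by
    intro i j e
    refine hWinj i j ?_
    have h1 := (ZMod.natCast_eq_natCast_iff' _ _ _).1 e
    rw [Nat.mod_eq_of_lt (hstep i).1, Nat.mod_eq_of_lt (hstep j).1] at h1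
    rw [← Nat.pair_unpair (W i), ← Nat.pair_unpair (W j), h1, hW, hW]
  have hne : ∀ i, u (i + 2) ≠ u i := by
    intro i e
    have h1 := huinj _ _ e
    have h2 : (i + 2) ≡ i + 0 [MOD k] := h1
    have h3 := Nat.ModEq.add_left_cancel' i h2
    rw [Nat.ModEq, Nat.mod_eq_of_lt (by omega), Nat.zero_mod] at h3
    omega
  obtain ⟨ε, hε, hε1⟩ : ∃ ε : ZMod (ℓ n), (ε = 1 ∨ ε = -1) ∧ ∀ i, u (i + 1) = u i + ε := by
    rcases hu 0 with h | h
    · refine ⟨1, .inl rfl, fun i => ?_⟩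
      induction i with
      | zero => exact h
      | succ i ih =>
        refine (hu (i + 1)).resolve_right fun e => hne i ?_
        rw [e, ih]
        ring
    · refine ⟨-1, .inr rfl, fun i => ?_⟩
      induction i with
      | zero => exact h
      | succ i ih =>
        refine (hu (i + 1)).resolve_left fun e => hne i ?_
        rw [e, ih]
        ring
  have hui : ∀ i : ℕ, u i = u 0 + i * ε := by
    intro i
    induction i with
    | zero => simp
    | succ i ih => rw [hε1, ih]; push_cast; ring
  have hzero : ∀ i : ℕ, u i = u 0 ↔ ℓ n ∣ i := by
    intro i
    rw [hui, add_eq_left, ← ZMod.natCast_eq_zero_iff]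
    rcases hε with rfl | rfl <;> simp
  have h1 : ℓ n ∣ k := (hzero k).1 (by simp [u, W])
  have h2 : k ∣ ℓ n := by
    have := huinj _ _ ((hzero (ℓ n)).2 dvd_rfl)
    exact Nat.dvd_of_mod_eq_zero (by simpa using this)
  exact ⟨n, Nat.dvd_antisymm h1 h2⟩

/-! ### Coding a set by cycle lengths -/

open Classical in
/-- The cycle lengths that code the set `S`. -/
noncomputable def codingLength (S : Set ℕ) (n : ℕ) : ℕ := if n ∈ S then 2 * n + 3 else 2 * n + 4

theorem three_le_codingLength (S : Set ℕ) (n : ℕ) : 3 ≤ codingLength S n := by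
  unfold codingLength
  split_ifs <;> omega

/-- Odd lengths come only from members and even ones only from non-members, and within each parity
the length determines `n`. -/
theorem mem_iff_hasCycle {S : Set ℕ} {n : ℕ} :
    n ∈ S ↔ HasCycle (ofGraph (cycleUnion (codingLength S))) (2 * n + 3) := by
  constructor
  · intro h
    have := hasCycle_cycleUnion_of_eq (three_le_codingLength S n)
    rwa [show codingLength S n = 2 * n + 3 by simp [codingLength, h]] at this
  · intro h
    obtain ⟨m, hm⟩ := exists_eq_of_hasCycle_cycleUnion (by omega) h
    unfold codingLength at hm
    split_ifs at hm with hmS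
    · obtain rfl : m = n := by omega
      exact hmS
    · omega

theorem notMem_iff_hasCycle {S : Set ℕ} {n : ℕ} :
    n ∉ S ↔ HasCycle (ofGraph (cycleUnion (codingLength S))) (2 * n + 4) := by
  constructor
  · intro h
    have := hasCycle_cycleUnion_of_eq (three_le_codingLength S n)
    rwa [show codingLength S n = 2 * n + 4 by simp [codingLength, h]] at this
  · intro h
    obtain ⟨m, hm⟩ := exists_eq_of_hasCycle_cycleUnion (by omega) h
    unfold codingLength at hm
    split_ifs at hm with hmS
    · omega
    · obtain rfl : m = n := by omega
      exact hmS

theorem primrec_two_mul_add (c : ℕ) : Primrec fun n : ℕ => 2 * n + c :=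
  Primrec.nat_add.comp (Primrec.nat_mul.comp (Primrec.const 2) Primrec.id) (Primrec.const c)

theorem isDeltaZeroTwo_of_sigTwo {S : Set ℕ}
    (h : SigTwo fun k => HasCycle (ofGraph (cycleUnion (codingLength S))) k) :
    IsDeltaZeroTwo S :=
  ⟨((h.comp (primrec_two_mul_add 3).to_comp).of_iff fun _ => mem_iff_hasCycle).isSigmaZeroTwo,
    ((h.comp (primrec_two_mul_add 4).to_comp).of_iff fun _ => notMem_iff_hasCycle).isSigmaZeroTwo⟩

/-- Each $\Sigma^0_2$ set is given by a program for its matrix, and Cantor's theorem forbids listing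
all sets by programs. -/
theorem exists_not_isDeltaZeroTwo : ∃ S : Set ℕ, ¬ IsDeltaZeroTwo S := by
  let F : Nat.Partrec.Code → Set ℕ := fun c =>
    {n | ∃ x : ℕ, ∀ y : ℕ, c.eval (Encodable.encode (n, x, y)) = Part.some (Encodable.encode true)}
  have hF : ∀ S, IsSigmaZeroTwo S → ∃ c, F c = S := by
    rintro S ⟨R, hR, hS⟩
    obtain ⟨f, hf, rfl⟩ := ComputablePred.computable_iff.1 hR
    obtain ⟨c, hc⟩ := Nat.Partrec.Code.exists_code.1 hf
    refine ⟨c, Set.ext fun n => ?_⟩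
    rw [hS]
    refine exists_congr fun x => forall_congr' fun y => ?_
    rw [hc]
    cases h : f (n, x, y) <;> simp [h]
  by_contra! H
  refine Function.cantor_surjective (fun n => F (Denumerable.ofNat Nat.Partrec.Code n))
    fun S => ?_
  obtain ⟨c, hc⟩ := hF S (H S).1
  exact ⟨Encodable.encode c, by simpa using hc⟩

end Graphs

end EffStr

/-! ### Conclusion -/

theorem mainTheorem5 :
    ∃ G : SimpleGraph ℕ,
      (∃ S : Set ℕ, ¬ EffStr.IsDeltaZeroTwo S ∧
        ∀ H : EffStr.Struc EffStr.binarySignature,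
          EffStr.IsCopy (EffStr.ofGraph G) H → EffStr.Computes H S) ∧
      (∀ L : LinearOrder ℕ,
        ¬ EffStr.MedvedevReducible (EffStr.ofGraph G) (EffStr.jump (EffStr.ofOrder L))) ∧
      (∀ L : LinearOrder ℕ,
        ¬ EffStr.IsSigmaTwoInterpreted (EffStr.ofGraph G) (EffStr.ofOrder L)) := by
  obtain ⟨S, hS⟩ := EffStr.exists_not_isDeltaZeroTwo
  refine ⟨EffStr.cycleUnion (EffStr.codingLength S), ⟨S, hS, fun H hH => ?_⟩, fun L hL => ?_,
    fun L hL => ?_⟩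
  · exact EffStr.computes_of_hasCycle (EffStr.primrec_two_mul_add 3)
      (EffStr.primrec_two_mul_add 4) (fun n => EffStr.mem_iff_hasCycle.trans hH.hasCycle)
      (fun n => EffStr.notMem_iff_hasCycle.trans hH.hasCycle)
  · exact hS (EffStr.isDeltaZeroTwo_of_sigTwo
      (EffStr.sigTwo_hasCycle_of_medvedevReducible (L := (L : EffStr.NatOrdering)) hL))
  · exact hS (EffStr.isDeltaZeroTwo_of_sigTwo
      (EffStr.sigTwo_hasCycle_of_isSigmaTwoInterpreted (L := (L : EffStr.NatOrdering)) hL))
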